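/- Let $A$ be a finite-dimensional real unital alternative $*$-algebra, $1\neq 0$, with involution $x\mapsto x^c$; put $t(x)=x+x^c$, $n(x)=xx^c$, $\mathbb S_A=\{J: t(J)=0,\ n(J)=1\}$, and assume $\mathbb S_A\neq\emptyset$. Let $Q_A=\mathbb R\cup\{x: t(x)\in\mathbb R,\ n(x)\in\mathbb R,\ t(x)^2<4n(x)\}=\bigcup_{J\in\mathbb S_A}\mathbb C_J$ be the quadratic cone, where $\mathbb C_J=\mathbb R+\mathbb R J$, and assume that $A$ has a norm with $\|x\|^2=n(x)$ on $Q_A$. A subset of $Q_A$ is circular if it has the form $\Omega_D=\{\alpha+\beta J: \alpha+i\beta\in D,\ J\in\mathbb S_A\}$ with $D\subseteq\mathbb C$, which can be taken invariant under conjugation; $\mathbb S_y$ is the smallest circular set containing $y$. Let $A_{\mathbb C}=A+\imath A$ be the complexification of $A$, with $(x+\imath y)^c=x^c+\imath y^c$. A function $f=\mathcal I(F)$ on $\Omega_D\neq\emptyset$ is a slice function if $f(\alpha+\beta J)=F_1(\alpha+i\beta)+JF_2(\alpha+i\beta)$ for a (unique) stem function $F=F_1+\imath F_2:D\to A_{\mathbb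 C}$, that is, one with $F(\bar z)=F_1(z)-\imath F_2(z)$; it is slice preserving if $F_1,F_2$ are real-valued, and slice regular if $\Omega_D$ is open in $Q_A$, $F$ is $C^1$ and $\partial F/\partial\bar z=0$. Put $\mathcal I(F)\cdot\mathcal I(G)=\mathcal I(FG)$, $\mathcal I(F)^c=\mathcal I(F^c)$, $N(f)=f\cdot f^c$. A slice function $f$ is tame if $N(f)$ is slice preserving and $N(f)=N(f^c)$. For $y\in Q_A$ let $\Delta_y(x)=x^2-x\,t(y)+n(y)$, $\mathrm u(x,y)=\|\Delta_y(x)\|^{1/2}$, $\mathrm U(y,r)=\{x\in Q_A:\mathrm u(x,y)<r\}$ and $\mathrm U(y,0,r)=\{x\in Q_A: 0<\mathrm u(x,y)<r\}$. Let $\Sigma(y,0,R)$ be the set of those $x\in Q_A$ with $0<|x-y|<R$ if $x,y$ lie in a common plane $\mathbb C_J$, and with $|\mathrm{Re}\,x-\mathrm{Re}\,y|^2+(|\mathrm{Im}\,x|-|\mathrm{Im}\,y|)^2>0$ and $|\mathrm{Re}\,x-\mathrm{Re}\,y|^2+(|\mathrm{Im}\,x|+|\mathrm{Im}\,y|)^2<R^2$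 otherwise. The point $y$ is a singularity of a slice regular $f$ on $\Omega'$ if $\Sigma(y,0,R)\subseteq\Omega'$ for some $R>0$. Then, for small radii, $f$ has a Laurent expansion $\sum_{n\in\mathbb Z}(x-y)^{\bullet n}\cdot a_n$ in $\Sigma(y,0,R)$ and a spherical Laurent expansion $\sum_{n\in\mathbb Z}\mathscr S_{y,n}\cdot c_n$ in $\mathrm U(y,0,r)$, where powers $^{\bullet n}$ are taken with respect to the slice product, $\mathscr S_{y,2k}=\Delta_y^k$ and $\mathscr S_{y,2k+1}=\Delta_y^k\cdot(x-y)$. The order $\mathrm{ord}_f(y)\in\mathbb N\cup\{\infty\}$ is the least $m$ with $a_n=0$ for all $n<-m$; the spherical order $\mathrm{ord}_f(\mathbb S_y)$ is the least even $m$ with $c_n=0$ for all $n<-m$. The singularity $y$ is a pole if $\mathrm{ord}_f(y)<\infty$, and removable if $f$ extends to a slice regular function on a circular open set containing $y$. If $\Omega$ is a nonempty circular open subset of $Q_A$, then $f$ is semiregular in $\Omega$ if it is slice regular on a circular open $\Omega'\subseteq\Omega$ and every point of $\Omega\setminus\Omega'$ is a pole or a removable singularity of $f$; it is tame in $\Omega$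 if it is tame on $\Omega'$. For $y\in\Omega\setminus\mathbb R$, the spherical multiplicity of a semiregular function $h$ at $\mathbb S_y$ is $\max\{0,2m\}$ if $h=\Delta_y^m g$ in some $\mathrm U(y,0,r)$ with $m\in\mathbb Z$ and $g$ slice regular on $\mathrm U(y,r)$, $g\not\equiv0$ in $\mathbb S_y$; for $y\in\Omega\cap\mathbb R$, the classical multiplicity of $h$ at $y$ is $\max\{0,n\}$ if $h=(x-y)^n g$ in some $\mathrm U(y,0,r)$ with $n\in\mathbb Z$ and $g$ slice regular on $\mathrm U(y,r)$, $g(y)\neq0$. Both are $\infty$ if $h\equiv0$ in some $\mathrm U(y,0,r)$. **Theorem.** Let $f$ be semiregular and tame in the circular open set $\Omega=\Omega_D$, slice regular on $\Omega'$ as above, and suppose that $N(f)\not\equiv0$; if $\Omega$ is not a single slice domain or product domain (that is, if $D$ is neither connected nor a pair of connected components exchanged by conjugation), suppose that $N(f)$ is not identically zero on any of the slice domains and product domains of which $\Omega$ is the disjoint union. Put $\Omega''=\{x\in\Omega': N(f)(x)\neq0\}$. Then: 1. $f^{-\bullet}(x):=N(f)(x)^{-1}f^c(x)$ is a slice function on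 $\Omega''$ with $f\cdot f^{-\bullet}=1=f^{-\bullet}\cdot f$; 2. $f^{-\bullet}$ is semiregular in $\Omega$: it is slice regular on $\Omega''$, and every point of $\Omega\setminus\Omega''$ is a pole or a removable singularity of it; 3. $f^{-\bullet}$ is tame in $\Omega$; 4. for every $y\in\Omega\setminus\mathbb R$, $\mathrm{ord}_{f^{-\bullet}}(\mathbb S_y)$ is at most the spherical multiplicity of $N(f)$ at $\mathbb S_y$ plus $\mathrm{ord}_f(\mathbb S_y)$; for every $y\in\Omega\cap\mathbb R$, $\mathrm{ord}_{f^{-\bullet}}(y)$ is at most the classical multiplicity of $N(f)$ at $y$ plus $\mathrm{ord}_f(y)$. In particular, where $f$ is slice regular (or has removable singularities), these orders are bounded by the multiplicities of $N(f)$. -/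

import Mathlib

/-! Slice regular and semiregular functions over a real alternative `*`-algebra. -/

noncomputable section

open scoped Classical

/-- A real unital `*`-algebra, not assumed associative, whose underlying real vector space carries
a norm. No compatibility between the norm and the product is asked for here. -/
class NormedStarAlg (A : Type*) extends NormedAddCommGroup A, NonAssocRing A, StarRing A,
    NormedSpace ℝ A where
  smul_mul_assoc' : ∀ (r : ℝ) (x y : A), (r • x) * y = r • (x * y)
  mul_smul_comm' : ∀ (r : ℝ) (x y : A), x * (r • y) = r • (x * y)
  star_smul' : ∀ (r : ℝ) (x : A), star (r • x) = r • star x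

namespace SliceReg

section Algebra

variable (A : Type*) [NormedStarAlg A]

/-- The sphere `𝕊_A` of imaginary units: `t(J) = 0` and `n(J) = 1`. -/
def imagUnits : Set A := {J | J + star J = 0 ∧ J * star J = 1}

/-- The quadratic cone `Q_A`. -/
def quadCone : Set A :=
  {x | (∃ r : ℝ, x = r • (1 : A)) ∨
    ∃ t n : ℝ, x + star x = t • (1 : A) ∧ x * star x = n • (1 : A) ∧ t ^ 2 < 4 * n}

/-- The standing assumptions on `A`: it is a nonzero alternative algebra of finite dimension, there
is an imaginary unit, and `‖x‖² = n(x)` for all `x` in the quadratic cone. -/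
class IsSliceAlg : Prop where
  one_ne_zero : (1 : A) ≠ 0
  left_alternative : ∀ x y : A, (x * x) * y = x * (x * y)
  right_alternative : ∀ x y : A, (y * x) * x = y * (x * x)
  finiteDimensional : FiniteDimensional ℝ A
  imagUnits_nonempty : (imagUnits A).Nonempty
  norm_sq : ∀ x ∈ quadCone A, x * star x = (‖x‖ ^ 2) • (1 : A)

end Algebra

section Coordinates

variable {A : Type*} [NormedStarAlg A]

/-- `α + β J`, for `z = α + i β`. -/
def pt (J : A) (z : ℂ) : A := z.re • (1 : A) + z.im • J

/-- The plane `ℂ_J`. -/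
def slice (J : A) : Set A := Set.range (pt J)

/-- The real part `t(x)/2`, as an element of `A`. -/
def reA (x : A) : A := (1 / 2 : ℝ) • (x + star x)

/-- The imaginary part `x - t(x)/2`. -/
def imA (x : A) : A := (1 / 2 : ℝ) • (x - star x)

/-- The real part as a real number (it is one whenever `x ∈ Q_A`). -/
def reR (x : A) : ℝ := if h : ∃ r : ℝ, reA x = r • (1 : A) then h.choose else 0

/-- The point `z = α + i β`, `β ≥ 0`, such that `x = α + β J` for some imaginary unit `J`. -/
def coord (x : A) : ℂ := ⟨reR x, ‖imA x‖⟩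

/-- The unit `J` in `x = α + β J`, `β > 0`; it is `0` when `x` is real. -/
def unitIm (x : A) : A := ‖imA x‖⁻¹ • imA x

/-- The circularization `Ω_E` of a set `E` of complex numbers. -/
def circ (E : Set ℂ) : Set A := {x | ∃ z ∈ E, ∃ J ∈ imagUnits A, x = pt J z}

/-- The sphere `𝕊_y`. -/
def sphere (y : A) : Set A := circ {coord y}

/-- The conjugation-invariant set `D` with `Ω = Ω_D`, for a circular set `Ω`. -/
def sliceDom (Ω : Set A) : Set ℂ := {z | ∃ J ∈ imagUnits A, pt J z ∈ Ω}

/-- `Ω` is circular and open in the quadratic cone. -/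
def IsCircularOpen (Ω : Set A) : Prop :=
  (∃ E : Set ℂ, Ω = circ E) ∧ ∃ U : Set A, IsOpen U ∧ Ω = U ∩ quadCone A

/-- The inverse `n(x)⁻¹ x^c` of a nonzero element `x` of the quadratic cone. -/
def coneInv (x : A) : A := (‖x‖ ^ 2)⁻¹ • star x

end Coordinates

section Complexification

/-! The complexified algebra `A_ℂ = A + ι A`; its elements `x + ι y` are written as pairs. -/

variable {A : Type*} [NormedStarAlg A]

/-- The product of `A_ℂ`. -/
def cmul (p q : A × A) : A × A := (p.1 * q.1 - p.2 * q.2, p.1 * q.2 + p.2 * q.1)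

/-- The involution `(x + ι y)^c = x^c + ι y^c`. -/
def cstar (p : A × A) : A × A := (star p.1, star p.2)

/-- The complex conjugation `x + ι y ↦ x - ι y`. -/
def cconj (p : A × A) : A × A := (p.1, -p.2)

/-- The action on `A_ℂ` of its central subalgebra `ℝ + ι ℝ ≃ ℂ`. -/
def csmul (c : ℂ) (p : A × A) : A × A :=
  (c.re • p.1 - c.im • p.2, c.re • p.2 + c.im • p.1)

/-- Powers in `A_ℂ`. -/
def cpow (p : A × A) : ℕ → A × A
  | 0 => (1, 0)
  | n + 1 => cmul p (cpow p n)

end Complexification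

section SliceFunctions

variable {A : Type*} [NormedStarAlg A]

/-! Functions on a subset `Ω` of `Q_A` are given by total functions `A → A`; only their values on
`Ω` matter. Likewise for stem functions. -/

/-- `F` is a stem function on `D`. -/
def IsStem (D : Set ℂ) (F : ℂ → A × A) : Prop :=
  ∀ z ∈ D, F (starRingEnd ℂ z) = cconj (F z)

/-- `f = I(F)` on `Ω`: `f(α + β J) = F₁(α + i β) + J F₂(α + i β)`. -/
def Induces (Ω : Set A) (F : ℂ → A × A) (f : A → A) : Prop :=
  ∀ z ∈ sliceDom Ω, ∀ J ∈ imagUnits A, f (pt J z) = (F z).1 + J * (F z).2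

/-- `f` is a slice function on the circular set `Ω`. -/
def IsSlice (Ω : Set A) (f : A → A) : Prop :=
  Ω.Nonempty ∧ (∃ E : Set ℂ, Ω = circ E) ∧
    ∃ F : ℂ → A × A, IsStem (sliceDom Ω) F ∧ Induces Ω F f

/-- The function `I(F)` induced by `F`. -/
def ind (F : ℂ → A × A) (x : A) : A := (F (coord x)).1 + unitIm x * (F (coord x)).2

variable (A) in
/-- Some imaginary unit. -/
def someUnit : A := Classical.epsilon (fun J : A => J ∈ imagUnits A)

/-- The stem function of a slice function, recovered from its values on one plane `ℂ_J`. The result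
does not depend on `J`, see `stem_eq` below. -/
def stem (f : A → A) (z : ℂ) : A × A :=
  ((1 / 2 : ℝ) • (f (pt (someUnit A) z) + f (pt (someUnit A) (starRingEnd ℂ z))),
    -((1 / 2 : ℝ) •
      (someUnit A * (f (pt (someUnit A) z) - f (pt (someUnit A) (starRingEnd ℂ z))))))

/-- The slice product `f · g = I(F G)`. -/
def sliceMul (f g : A → A) : A → A := ind (fun z => cmul (stem f z) (stem g z))

/-- The conjugate function `f^c = I(F^c)`. -/
def sliceConj (f : A → A) : A → A := ind (fun z => cstar (stem f z))

/-- The normal function `N(f) = f · f^c`. -/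
def normalFn (f : A → A) : A → A := sliceMul f (sliceConj f)

/-- `f` is slice preserving on `Ω`: it is induced by a stem function with real components. -/
def IsSlicePreserving (Ω : Set A) (f : A → A) : Prop :=
  Ω.Nonempty ∧ (∃ E : Set ℂ, Ω = circ E) ∧
    ∃ F : ℂ → A × A, IsStem (sliceDom Ω) F ∧ Induces Ω F f ∧
      ∀ z ∈ sliceDom Ω, ∃ a b : ℝ, F z = (a • (1 : A), b • (1 : A))

/-- A slice function `f` on `Ω` is tame if `N(f)` is slice preserving and equals `N(f^c)`. -/
def IsTame (Ω : Set A) (f : A → A) : Prop :=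
  IsSlice Ω f ∧ IsSlicePreserving Ω (normalFn f) ∧
    ∀ x ∈ Ω, normalFn f x = normalFn (sliceConj f) x

/-- `∂F/∂z̄ = (∂F/∂α + ι ∂F/∂β) / 2`. -/
def dbar (F : ℂ → A × A) (z : ℂ) : A × A :=
  (1 / 2 : ℝ) • (fderiv ℝ F z 1 + csmul Complex.I (fderiv ℝ F z Complex.I))

/-- `f ∈ SR(Ω)`: `Ω` is nonempty, circular and open in `Q_A`, and `f` is induced by a `C¹` stem
function `F` with `∂F/∂z̄ = 0`. -/
def IsSliceRegular (Ω : Set A) (f : A → A) : Prop :=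
  Ω.Nonempty ∧ IsCircularOpen Ω ∧
    ∃ F : ℂ → A × A, IsStem (sliceDom Ω) F ∧ Induces Ω F f ∧
      ContDiffOn ℝ 1 F (sliceDom Ω) ∧ ∀ z ∈ sliceDom Ω, dbar F z = 0

/-- The function `x ↦ N(f)(x)⁻¹ f^c(x)`. -/
def sliceInv (f : A → A) (x : A) : A := coneInv (normalFn f x) * sliceConj f x

end SliceFunctions

section Singularities

variable {A : Type*} [NormedStarAlg A]

/-- `x` and `y` lie in the same plane `ℂ_J`. -/
def SameSlice (x y : A) : Prop := ∃ J ∈ imagUnits A, x ∈ slice J ∧ y ∈ slice J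

/-- The function `σ_A`. -/
def sigmaDist (x y : A) : ℝ :=
  if SameSlice x y then ‖x - y‖
  else Real.sqrt (‖reA x - reA y‖ ^ 2 + (‖imA x‖ + ‖imA y‖) ^ 2)

/-- The function `τ_A`. -/
def tauDist (x y : A) : ℝ :=
  if SameSlice x y then ‖x - y‖
  else Real.sqrt (‖reA x - reA y‖ ^ 2 + (‖imA x‖ - ‖imA y‖) ^ 2)

/-- The set `Σ(y, R₁, R₂)`. -/
def sigmaShell (y : A) (R₁ R₂ : ℝ) : Set A :=
  {x ∈ quadCone A | R₁ < tauDist x y ∧ sigmaDist x y < R₂}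

/-- The Cassini pseudodistance `u(x, y) = ‖Δ_y(x)‖^{1/2}`, `Δ_y(x) = x² - x t(y) + n(y)`. -/
def cassini (x y : A) : ℝ := Real.sqrt ‖x * x - x * (y + star y) + y * star y‖

/-- The Cassini ball `U(y, r)`. -/
def cassiniBall (y : A) (r : ℝ) : Set A := {x ∈ quadCone A | cassini x y < r}

/-- The Cassini shell `U(y, r₁, r₂)`. -/
def cassiniShell (y : A) (r₁ r₂ : ℝ) : Set A :=
  {x ∈ quadCone A | r₁ < cassini x y ∧ cassini x y < r₂}

/-- The stem function of `Δ_y`, with values in `ℝ + ι ℝ ≃ ℂ`. -/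
def deltaStem (y : A) (z : ℂ) : ℂ := z ^ 2 - z * ((2 * reR y : ℝ) : ℂ) + ((‖y‖ ^ 2 : ℝ) : ℂ)

/-- The stem function of `x ↦ x - y`. -/
def binomStem (y : A) (z : ℂ) : A × A := (z.re • (1 : A) - y, z.im • (1 : A))

/-- The stem function of the slice inverse `(x - y)^{-•} = Δ_y(x)⁻¹ (x - y^c)`. -/
def binomInvStem (y : A) (z : ℂ) : A × A := csmul (deltaStem y z)⁻¹ (binomStem (star y) z)

/-- The stem function of `(x - y)^{• n}`. -/
def binomZPowStem (y : A) (n : ℤ) (z : ℂ) : A × A :=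
  match n with
  | Int.ofNat k => cpow (binomStem y z) k
  | Int.negSucc k => cpow (binomInvStem y z) (k + 1)

/-- The term `(x - y)^{• n} · a` of a Laurent series. -/
def laurentTerm (y : A) (n : ℤ) (a : A) : A → A :=
  ind (fun z => cmul (binomZPowStem y n z) (a, 0))

/-- The term `S_{y,n} · c` of a spherical Laurent series, where `S_{y,2k} = Δ_y^k` and
`S_{y,2k+1} = Δ_y^k · (x - y)`. -/
def sphericalTerm (y : A) (n : ℤ) (c : A) : A → A :=
  ind (fun z => csmul (deltaStem y z ^ (n / 2))
    (if Even n then (c, 0) else cmul (binomStem y z) (c, 0)))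

/-- `y` is a singularity for a slice regular function on `Ω`. -/
def IsSingularity (Ω : Set A) (y : A) : Prop :=
  y ∈ quadCone A ∧ ∃ R : ℝ, 0 < R ∧ sigmaShell y 0 R ⊆ Ω

/-- `∑ₙ (x - y)^{• n} · aₙ` is the Laurent expansion at `y` of the function `f` on `Ω`. -/
def IsLaurentExpansion (Ω : Set A) (f : A → A) (y : A) (a : ℤ → A) : Prop :=
  ∃ R : ℝ, 0 < R ∧ sigmaShell y 0 R ⊆ Ω ∧
    ∀ x ∈ sigmaShell y 0 R, HasSum (fun n : ℤ => laurentTerm y n (a n) x) (f x)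

/-- The order `ord_f(y)`. -/
def ord (Ω : Set A) (f : A → A) (y : A) : ℕ∞ :=
  sInf {m | ∃ k : ℕ, m = (k : ℕ∞) ∧
    ∃ a : ℤ → A, IsLaurentExpansion Ω f y a ∧ ∀ n : ℤ, n < -(k : ℤ) → a n = 0}

/-- `y` is a pole for the function `f` on `Ω`. -/
def IsPole (Ω : Set A) (f : A → A) (y : A) : Prop := IsSingularity Ω y ∧ ord Ω f y < ⊤

/-- `y` is a removable singularity for the function `f` on `Ω`. -/
def IsRemovable (Ω : Set A) (f : A → A) (y : A) : Prop :=
  IsSingularity Ω y ∧ ∃ (Ω₁ : Set A) (g : A → A),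
    Ω ⊆ Ω₁ ∧ y ∈ Ω₁ ∧ IsSliceRegular Ω₁ g ∧ ∀ x ∈ Ω, g x = f x

/-- `∑ₙ S_{y,n} · cₙ` is the spherical Laurent expansion at `y` of the function `f` on `Ω`. -/
def IsSphericalExpansion (Ω : Set A) (f : A → A) (y : A) (c : ℤ → A) : Prop :=
  ∃ r : ℝ, 0 < r ∧ cassiniShell y 0 r ⊆ Ω ∧
    ∀ x ∈ cassiniShell y 0 r, HasSum (fun n : ℤ => sphericalTerm y n (c n) x) (f x)

/-- The spherical order `ord_f(𝕊_y)`. -/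
def sphericalOrd (Ω : Set A) (f : A → A) (y : A) : ℕ∞ :=
  sInf {m | ∃ k : ℕ, m = ((2 * k : ℕ) : ℕ∞) ∧
    ∃ c : ℤ → A, IsSphericalExpansion Ω f y c ∧ ∀ n : ℤ, n < -((2 * k : ℕ) : ℤ) → c n = 0}

/-- `f = Δ_y^m g` near `𝕊_y` (off `𝕊_y`), with `g` slice regular near `𝕊_y` and not identically
zero in `𝕊_y`. -/
def HasSphericalFactor (Ω : Set A) (f : A → A) (y : A) (m : ℤ) : Prop :=
  ∃ r : ℝ, 0 < r ∧ cassiniShell y 0 r ⊆ Ω ∧ ∃ g : A → A,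
    IsSliceRegular (cassiniBall y r) g ∧ (∃ w ∈ sphere y, g w ≠ 0) ∧
      ∀ x ∈ cassiniShell y 0 r, f x = ind (fun z => csmul (deltaStem y z ^ m) (stem g z)) x

/-- The spherical multiplicity of `f` at `𝕊_y`, `y` not real: it is `2m` if `f = Δ_y^m g` as above
with `m ≥ 0`, it is `0` if `m < 0`, and it is `∞` if `f` vanishes identically near `𝕊_y`. -/
def sphericalMult (Ω : Set A) (f : A → A) (y : A) : ℕ∞ :=
  sInf {k | ∃ m : ℤ, HasSphericalFactor Ω f y m ∧ k = ((2 * m.toNat : ℕ) : ℕ∞)}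

/-- For real `y`: `f = (x - y)^n h` near `y` (off `y`), with `h` slice regular near `y` and
`h(y) ≠ 0`. -/
def HasRealFactor (Ω : Set A) (f : A → A) (y : A) (n : ℤ) : Prop :=
  ∃ r : ℝ, 0 < r ∧ cassiniShell y 0 r ⊆ Ω ∧ ∃ h : A → A,
    IsSliceRegular (cassiniBall y r) h ∧ h y ≠ 0 ∧
      ∀ x ∈ cassiniShell y 0 r,
        f x = ind (fun z => csmul ((z - ((reR y : ℝ) : ℂ)) ^ n) (stem h z)) x

/-- The classical multiplicity of `f` at the real point `y`: it is `n` if `f = (x - y)^n h` as above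
with `n ≥ 0`, it is `0` if `n < 0`, and it is `∞` if `f` vanishes identically near `y`. -/
def classicalMult (Ω : Set A) (f : A → A) (y : A) : ℕ∞ :=
  sInf {k | ∃ n : ℤ, HasRealFactor Ω f y n ∧ k = ((n.toNat : ℕ) : ℕ∞)}

/-- `f`, defined and slice regular on `Ω'`, is semiregular in `Ω`. -/
def IsSemiregular (Ω Ω' : Set A) (f : A → A) : Prop :=
  Ω.Nonempty ∧ IsCircularOpen Ω ∧ Ω' ⊆ Ω ∧ IsSliceRegular Ω' f ∧
    ∀ y ∈ Ω \ Ω', IsPole Ω' f y ∨ IsRemovable Ω' f y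

/-- `h`, defined on `Ω' ⊆ Ω`, vanishes identically on none of the slice domains and product domains
of which `Ω` is the disjoint union. If `Ω` is itself a slice domain or a product domain, this says
that `h` is not identically zero. -/
def NowhereIdenticallyZero (Ω Ω' : Set A) (h : A → A) : Prop :=
  ∀ z ∈ sliceDom Ω, ∃ x ∈ Ω' ∩ circ (connectedComponentIn (sliceDom Ω) z), h x ≠ 0

end Singularities

section Checks

variable {A : Type*} [NormedStarAlg A]

theorem smul_mul_A (r : ℝ) (x y : A) : (r • x) * y = r • (x * y) :=
  NormedStarAlg.smul_mul_assoc' r x y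

theorem mul_smul_A (r : ℝ) (x y : A) : x * (r • y) = r • (x * y) :=
  NormedStarAlg.mul_smul_comm' r x y

theorem star_smul_A (r : ℝ) (x : A) : star (r • x) = r • star x :=
  NormedStarAlg.star_smul' r x

theorem star_one_A : star (1 : A) = 1 := by
  have h : star (star (1 : A) * 1) = star (star (1 : A)) := by rw [mul_one]
  rw [star_mul, star_star, mul_one] at h
  exact h

theorem star_unit {J : A} (hJ : J ∈ imagUnits A) : star J = -J :=
  (neg_eq_of_add_eq_zero_right hJ.1).symm

theorem unit_sq {J : A} (hJ : J ∈ imagUnits A) : J * J = -1 := by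
  have h := hJ.2
  rw [star_unit hJ, mul_neg] at h
  rw [← h, neg_neg]

theorem star_pt {J : A} (hJ : J ∈ imagUnits A) (z : ℂ) :
    star (pt J z) = pt J (starRingEnd ℂ z) := by
  simp only [pt, star_add, star_smul_A, star_one_A, star_unit hJ, Complex.conj_re, Complex.conj_im,
    smul_neg, neg_smul]

theorem imA_pt {J : A} (hJ : J ∈ imagUnits A) (z : ℂ) : imA (pt J z) = z.im • J := by
  rw [imA, star_pt hJ]
  simp only [pt, Complex.conj_re, Complex.conj_im]
  module

theorem reA_pt {J : A} (hJ : J ∈ imagUnits A) (z : ℂ) : reA (pt J z) = z.re • (1 : A) := by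
  rw [reA, star_pt hJ]
  simp only [pt, Complex.conj_re, Complex.conj_im]
  module

variable [IsSliceAlg A]

theorem someUnit_mem : someUnit A ∈ imagUnits A :=
  Classical.epsilon_spec (p := fun J : A => J ∈ imagUnits A) IsSliceAlg.imagUnits_nonempty

theorem unit_mul_unit_mul {J : A} (hJ : J ∈ imagUnits A) (x : A) : J * (J * x) = -x := by
  rw [← IsSliceAlg.left_alternative, unit_sq hJ, neg_mul, one_mul]

theorem norm_unit {J : A} (hJ : J ∈ imagUnits A) : ‖J‖ = 1 := by
  have hq : J ∈ quadCone A :=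
    Or.inr ⟨0, 1, by simpa using hJ.1, by simpa using hJ.2, by norm_num⟩
  have h := IsSliceAlg.norm_sq J hq
  rw [hJ.2] at h
  have h' : (‖J‖ ^ 2 - 1) • (1 : A) = 0 := by rw [sub_smul, ← h, one_smul, sub_self]
  rcases smul_eq_zero.1 h' with h0 | h0
  · nlinarith [norm_nonneg J]
  · exact absurd h0 IsSliceAlg.one_ne_zero

theorem reR_pt {J : A} (hJ : J ∈ imagUnits A) (z : ℂ) : reR (pt J z) = z.re := by
  have h : ∃ r : ℝ, reA (pt J z) = r • (1 : A) := ⟨z.re, reA_pt hJ z⟩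
  rw [reR, dif_pos h]
  have h1 : z.re • (1 : A) = h.choose • (1 : A) := (reA_pt hJ z).symm.trans h.choose_spec
  exact (smul_left_injective ℝ (IsSliceAlg.one_ne_zero (A := A)) h1).symm

theorem coord_pt {J : A} (hJ : J ∈ imagUnits A) (z : ℂ) : coord (pt J z) = ⟨z.re, |z.im|⟩ := by
  rw [coord, reR_pt hJ, imA_pt hJ, norm_smul, norm_unit hJ, mul_one, Real.norm_eq_abs]

/-- A slice function is induced by exactly one stem function, namely by `stem f`. -/
theorem stem_eq {Ω : Set A} {F : ℂ → A × A} {f : A → A} (hF : IsStem (sliceDom Ω) F)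
    (hΩ : ∀ z ∈ sliceDom Ω, starRingEnd ℂ z ∈ sliceDom Ω) (hf : Induces Ω F f) {z : ℂ}
    (hz : z ∈ sliceDom Ω) : stem f z = F z := by
  have hJ := someUnit_mem (A := A)
  have h1 := hf z hz _ hJ
  have h2 := hf _ (hΩ z hz) _ hJ
  rw [hF z hz] at h2
  simp only [cconj, mul_neg] at h2
  ext
  · simp only [stem, h1, h2]
    module
  · have e : (F z).1 + someUnit A * (F z).2 - ((F z).1 + -(someUnit A * (F z).2)) =
        (2 : ℝ) • (someUnit A * (F z).2) := by module
    simp only [stem, h1, h2, e, mul_smul_A, unit_mul_unit_mul hJ]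
    module

/-- `ind F` is the function induced by the stem function `F`. -/
theorem induces_ind {Ω : Set A} {F : ℂ → A × A} (hF : IsStem (sliceDom Ω) F) :
    Induces Ω F (ind F) := by
  intro z hz J hJ
  rw [ind, coord_pt hJ, unitIm, imA_pt hJ, norm_smul, norm_unit hJ, mul_one, Real.norm_eq_abs]
  have hs := hF z hz
  rcases lt_trichotomy z.im 0 with h | h | h
  · have e : (⟨z.re, |z.im|⟩ : ℂ) = starRingEnd ℂ z := by
      apply Complex.ext <;> simp [abs_of_neg h]
    rw [e, hs, abs_of_neg h, smul_smul, inv_neg, neg_mul, inv_mul_cancel₀ h.ne]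
    simp [cconj]
  · have e : (⟨z.re, |z.im|⟩ : ℂ) = z := by apply Complex.ext <;> simp [h]
    have e2 : starRingEnd ℂ z = z := by apply Complex.ext <;> simp [h]
    rw [e2] at hs
    have h0 : (F z).2 = 0 := by
      have h3 : (F z).2 = -(F z).2 := congrArg Prod.snd hs
      have h4 : (2 : ℝ) • (F z).2 = 0 := by
        rw [two_smul]; nth_rewrite 1 [h3]; exact neg_add_cancel _
      simpa using h4
    rw [e, h0, mul_zero, mul_zero]
  · have e : (⟨z.re, |z.im|⟩ : ℂ) = z := by apply Complex.ext <;> simp [abs_of_pos h]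
    rw [e, abs_of_pos h, smul_smul, inv_mul_cancel₀ h.ne', one_smul]

end Checks

end SliceReg

end

/-!
A slice function is determined by its stem function, a map from a plane domain to the
finite-dimensional complex space `A_ℂ`, and slice regularity means that this map is holomorphic.
For tame `f` with stem `F` the product `F F^c` is a scalar function `u`, and `f^{-•}` has stem
`u⁻¹ F^c`; the algebraic claims are then identities in `A_ℂ`. A pole or removable singularity of
`f` is a point where `F` is meromorphic. So `u` is meromorphic, it has isolated zeros by the
identity theorem on the components of the plane domain, and `u⁻¹ F^c` is again meromorphic.

The (spherical) order of `f` at `y` bounds the pole order of `F` at the zeros of the stem `δ` of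
`Δ_y`, or of `x - y` for real `y`, while the multiplicity of `N(f)` is the exponent `m` for which
`δ^(-m) u` is holomorphic without zeros there. Pole orders of products add, so the pole order of
`u⁻¹ F^c` is at most the sum of the two; conversely, a bound on the pole order of the stem bounds
the order, through the Laurent coefficients. For non-real `y` a bound at both zeros `ζ` and `conj ζ`
of `δ` is needed, and the even spherical order `2k` measures the exponent `k` of `δ`.
-/

noncomputable section

namespace SliceReg

open scoped ComplexConjugate Topology

open Filter

/-! ### The planes `ℂ_J` and circular sets -/

section Planes

variable {A : Type*} [NormedStarAlg A]

theorem neg_mem_imagUnits {J : A} (hJ : J ∈ imagUnits A) : -J ∈ imagUnits A := by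
  refine ⟨?_, by rw [star_neg, neg_mul_neg, hJ.2]⟩
  rw [star_neg, ← neg_add, hJ.1, neg_zero]

theorem pt_neg (J : A) (z : ℂ) : pt (-J) z = pt J (conj z) := by
  simp only [pt, Complex.conj_re, Complex.conj_im, smul_neg, neg_smul]

theorem pt_sub (J : A) (u v : ℂ) : pt J (u - v) = pt J u - pt J v := by
  simp only [pt, Complex.sub_re, Complex.sub_im]
  module

theorem pt_of_im_eq_zero (J : A) {z : ℂ} (hz : z.im = 0) : pt J z = z.re • (1 : A) := by
  rw [pt, hz, zero_smul, add_zero]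

theorem pt_ofReal (J : A) (r : ℝ) : pt J (r : ℂ) = r • (1 : A) :=
  pt_of_im_eq_zero J (Complex.ofReal_im r)

theorem pt_mul_apply (J : A) (u : ℂ) (x : A) : pt J u * x = u.re • x + u.im • (J * x) := by
  rw [pt, add_mul, smul_mul_A, smul_mul_A, one_mul]

theorem continuous_pt (J : A) : Continuous (pt J) := by
  unfold pt
  fun_prop

theorem pt_add_star {J : A} (hJ : J ∈ imagUnits A) (z : ℂ) :
    pt J z + star (pt J z) = (2 * z.re) • (1 : A) := by
  rw [star_pt hJ]
  simp only [pt, Complex.conj_re, Complex.conj_im]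
  module

/-- The imaginary unit of a non-real `x` is its trace-free part, normalized. -/
theorem exists_eq_pt_of_trace_norm {x : A} {t n : ℝ} (ht : x + star x = t • (1 : A))
    (hn : x * star x = n • (1 : A)) (htn : t ^ 2 < 4 * n) :
    ∃ J ∈ imagUnits A, ∃ z : ℂ, x = pt J z := by
  set s : ℝ := Real.sqrt (n - t ^ 2 / 4)
  have hs_sq : s ^ 2 = n - t ^ 2 / 4 := Real.sq_sqrt (by linarith)
  have hs : s ≠ 0 := (Real.sqrt_pos.2 (by linarith)).ne'
  set v : A := x - (t / 2) • (1 : A) with hv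
  have hstar : star x = t • (1 : A) - x := eq_sub_of_add_eq' ht
  have hstar_v : star v = -v := by
    rw [hv, star_sub, star_smul_A, star_one_A, hstar]
    module
  have hx_sq : x * x = t • x - n • (1 : A) := by
    rw [hstar, mul_sub, mul_smul_A, mul_one] at hn
    rw [← hn, sub_sub_cancel]
  have hv_sq : v * v = -(s ^ 2 • (1 : A)) := by
    rw [hs_sq, hv]
    simp only [sub_mul, mul_sub, smul_mul_A, mul_smul_A, one_mul, mul_one, hx_sq]
    module
  refine ⟨s⁻¹ • v, ⟨?_, ?_⟩, ⟨t / 2, s⟩, ?_⟩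
  · rw [star_smul_A, hstar_v, smul_neg, add_neg_cancel]
  · rw [star_smul_A, hstar_v, smul_mul_A, mul_smul_A, mul_neg, hv_sq, neg_neg, smul_smul,
      smul_smul, show s⁻¹ * s⁻¹ * s ^ 2 = 1 by field_simp, one_smul]
  · simp only [pt, smul_inv_smul₀ hs, hv, add_sub_cancel]

variable [IsSliceAlg A]

theorem pt_mul_mul {J : A} (hJ : J ∈ imagUnits A) (u v : ℂ) (x : A) :
    pt J u * (pt J v * x) = pt J (u * v) * x := by
  simp only [pt_mul_apply, mul_add, mul_smul_A, unit_mul_unit_mul hJ, Complex.mul_re,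
    Complex.mul_im]
  module

theorem pt_mul {J : A} (hJ : J ∈ imagUnits A) (u v : ℂ) : pt J u * pt J v = pt J (u * v) := by
  simpa only [mul_one] using pt_mul_mul hJ u v 1

theorem pt_mul_star {J : A} (hJ : J ∈ imagUnits A) (z : ℂ) :
    pt J z * star (pt J z) = (‖z‖ ^ 2) • (1 : A) := by
  rw [star_pt hJ, pt_mul hJ, Complex.mul_conj, pt_ofReal, Complex.normSq_eq_norm_sq]

theorem mem_quadCone_iff {x : A} :
    x ∈ quadCone A ↔ ∃ J ∈ imagUnits A, ∃ z : ℂ, x = pt J z := by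
  constructor
  · rintro (⟨r, rfl⟩ | ⟨t, n, ht, hn, htn⟩)
    · exact ⟨_, someUnit_mem, r, (pt_ofReal _ r).symm⟩
    · exact exists_eq_pt_of_trace_norm ht hn htn
  · rintro ⟨J, hJ, z, rfl⟩
    by_cases hz : z.im = 0
    · exact Or.inl ⟨z.re, pt_of_im_eq_zero J hz⟩
    · refine Or.inr ⟨2 * z.re, ‖z‖ ^ 2, pt_add_star hJ z, pt_mul_star hJ z, ?_⟩
      rw [Complex.sq_norm, Complex.normSq_apply]
      nlinarith [sq_pos_of_ne_zero hz]

theorem pt_mem_quadCone {J : A} (hJ : J ∈ imagUnits A) (z : ℂ) : pt J z ∈ quadCone A :=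
  mem_quadCone_iff.2 ⟨J, hJ, z, rfl⟩

theorem norm_pt {J : A} (hJ : J ∈ imagUnits A) (z : ℂ) : ‖pt J z‖ = ‖z‖ := by
  have h := IsSliceAlg.norm_sq _ (pt_mem_quadCone hJ z)
  rw [pt_mul_star hJ] at h
  have h_sq : ‖z‖ ^ 2 = ‖pt J z‖ ^ 2 := smul_left_injective ℝ IsSliceAlg.one_ne_zero h
  exact ((sq_eq_sq₀ (norm_nonneg _) (norm_nonneg _)).1 h_sq).symm

theorem pt_eq_zero_iff {J : A} (hJ : J ∈ imagUnits A) {z : ℂ} : pt J z = 0 ↔ z = 0 := by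
  rw [← norm_eq_zero, norm_pt hJ, norm_eq_zero]

theorem coneInv_pt {J : A} (hJ : J ∈ imagUnits A) (z : ℂ) : coneInv (pt J z) = pt J z⁻¹ := by
  rw [coneInv, norm_pt hJ, star_pt hJ]
  simp only [pt, Complex.inv_re, Complex.inv_im, Complex.conj_re, Complex.conj_im, smul_add,
    smul_smul, Complex.sq_norm]
  congr 2 <;> ring

theorem coord_pt_eq_or {J : A} (hJ : J ∈ imagUnits A) (z : ℂ) :
    coord (pt J z) = z ∨ coord (pt J z) = conj z := by
  rw [coord_pt hJ]
  rcases abs_choice z.im with h | h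
  · exact Or.inl (Complex.ext rfl h)
  · exact Or.inr (Complex.ext rfl h)

theorem exists_eq_pt_coord {x : A} (hx : x ∈ quadCone A) :
    ∃ J ∈ imagUnits A, x = pt J (coord x) := by
  obtain ⟨J, hJ, z, rfl⟩ := mem_quadCone_iff.1 hx
  rcases coord_pt_eq_or hJ z with h | h
  · exact ⟨J, hJ, by rw [h]⟩
  · exact ⟨-J, neg_mem_imagUnits hJ, by rw [h, pt_neg, Complex.conj_conj]⟩

theorem coord_im_eq_zero_iff {y : A} (hy : y ∈ quadCone A) :
    (coord y).im = 0 ↔ y ∈ Set.range (fun r : ℝ => r • (1 : A)) := by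
  constructor
  · intro h_im
    obtain ⟨J, -, h⟩ := exists_eq_pt_coord hy
    exact ⟨(coord y).re, (pt_of_im_eq_zero J h_im).symm.trans h.symm⟩
  · rintro ⟨r, rfl⟩
    change (coord (r • (1 : A))).im = 0
    rw [← pt_ofReal (someUnit A) r, coord_pt someUnit_mem, Complex.ofReal_im, abs_zero]

end Planes

section CircularSets

variable {A : Type*} [NormedStarAlg A]

/-- Circular subsets of the quadratic cone; reducible, because the definitions above spell the
existential out. -/
abbrev IsCircular (Ω : Set A) : Prop := ∃ E : Set ℂ, Ω = circ E

theorem sliceDom_mono {Ω Ω₁ : Set A} (h : Ω₁ ⊆ Ω) : sliceDom Ω₁ ⊆ sliceDom Ω :=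
  fun _ ⟨J, hJ, hz⟩ => ⟨J, hJ, h hz⟩

theorem continuous_star_A [FiniteDimensional ℝ A] : Continuous (star : A → A) :=
  LinearMap.continuous_of_finiteDimensional
    { toFun := star, map_add' := star_add, map_smul' := star_smul_A : A →ₗ[ℝ] A }

variable [IsSliceAlg A]

theorem pt_eq_pt {J J' : A} (hJ : J ∈ imagUnits A) (hJ' : J' ∈ imagUnits A) {z w : ℂ}
    (h : pt J z = pt J' w) : w = z ∨ w = conj z := by
  have h_coord := coord_pt hJ z
  rw [h, coord_pt hJ'] at h_coord
  obtain ⟨hre, him⟩ := Complex.ext_iff.1 h_coord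
  rcases abs_eq_abs.1 him with him | him
  · exact Or.inl (Complex.ext hre him)
  · exact Or.inr (Complex.ext hre him)

theorem pt_mem_circ_iff {J : A} (hJ : J ∈ imagUnits A) {E : Set ℂ} {z : ℂ} :
    pt J z ∈ circ (A := A) E ↔ z ∈ E ∨ conj z ∈ E := by
  constructor
  · rintro ⟨w, hw, J', hJ', h⟩
    rcases pt_eq_pt hJ hJ' h with rfl | rfl
    · exact Or.inl hw
    · exact Or.inr hw
  · rintro (h | h)
    · exact ⟨z, h, J, hJ, rfl⟩
    · exact ⟨_, h, -J, neg_mem_imagUnits hJ, by rw [pt_neg, Complex.conj_conj]⟩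

theorem mem_sliceDom_circ {E : Set ℂ} {z : ℂ} :
    z ∈ sliceDom (circ (A := A) E) ↔ z ∈ E ∨ conj z ∈ E :=
  ⟨fun ⟨_, hJ, h⟩ => (pt_mem_circ_iff hJ).1 h,
    fun h => ⟨_, someUnit_mem, (pt_mem_circ_iff someUnit_mem).2 h⟩⟩

theorem sliceDom_circ {E : Set ℂ} (hE : ∀ z ∈ E, conj z ∈ E) :
    sliceDom (circ (A := A) E) = E := by
  ext z
  rw [mem_sliceDom_circ]
  exact ⟨fun h => h.elim id fun hz => by simpa only [Complex.conj_conj] using hE _ hz, Or.inl⟩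

theorem IsCircular.pt_mem_iff {Ω : Set A} (h : IsCircular Ω) {J : A} (hJ : J ∈ imagUnits A)
    {z : ℂ} : pt J z ∈ Ω ↔ z ∈ sliceDom Ω := by
  obtain ⟨E, rfl⟩ := h
  rw [pt_mem_circ_iff hJ, mem_sliceDom_circ]

theorem IsCircular.conj_mem {Ω : Set A} (h : IsCircular Ω) {z : ℂ} (hz : z ∈ sliceDom Ω) :
    conj z ∈ sliceDom Ω := by
  obtain ⟨E, rfl⟩ := h
  rw [mem_sliceDom_circ] at hz ⊢
  rw [Complex.conj_conj]
  exact hz.symm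

theorem IsCircular.subset_quadCone {Ω : Set A} (h : IsCircular Ω) : Ω ⊆ quadCone A := by
  obtain ⟨E, rfl⟩ := h
  rintro x ⟨z, -, J, hJ, rfl⟩
  exact pt_mem_quadCone hJ z

theorem IsCircular.coord_mem_iff {Ω : Set A} (h : IsCircular Ω) {x : A} (hx : x ∈ quadCone A) :
    coord x ∈ sliceDom Ω ↔ x ∈ Ω := by
  obtain ⟨J, hJ, e⟩ := exists_eq_pt_coord hx
  rw [← h.pt_mem_iff hJ, ← e]

theorem IsCircular.coord_mem {Ω : Set A} (h : IsCircular Ω) {x : A} (hx : x ∈ Ω) :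
    coord x ∈ sliceDom Ω :=
  (h.coord_mem_iff (h.subset_quadCone hx)).2 hx

theorem IsCircularOpen.isOpen_sliceDom {Ω : Set A} (h : IsCircularOpen Ω) :
    IsOpen (sliceDom Ω) := by
  obtain ⟨hc, U, hU, hΩ⟩ := h
  suffices sliceDom Ω = pt (someUnit A) ⁻¹' U from this ▸ hU.preimage (continuous_pt _)
  ext z
  rw [← IsCircular.pt_mem_iff hc someUnit_mem, hΩ, Set.mem_preimage]
  exact and_iff_left (pt_mem_quadCone someUnit_mem z)

attribute [local instance] IsSliceAlg.finiteDimensional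

theorem continuousOn_coord : ContinuousOn (coord : A → ℂ) (quadCone A) := by
  have h_star := continuous_star_A (A := A)
  have h_reA : Continuous (reA : A → A) := (continuous_id.add h_star).const_smul _
  have h_imA : Continuous (imA : A → A) := (continuous_id.sub h_star).const_smul _
  obtain ⟨l, hl⟩ := SeparatingDual.exists_eq_one (R := ℝ) (IsSliceAlg.one_ne_zero (A := A))
  have h_reR : ∀ x ∈ quadCone A, reR x = l (reA x) := by
    intro x hx
    obtain ⟨J, hJ, z, rfl⟩ := mem_quadCone_iff.1 hx
    rw [reR_pt hJ, reA_pt hJ, map_smul, hl, smul_eq_mul, mul_one]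
  have h_cont : Continuous fun x : A => ((l (reA x) : ℝ) : ℂ) + (‖imA x‖ : ℝ) * Complex.I := by
    fun_prop
  refine h_cont.continuousOn.congr fun x hx => ?_
  apply Complex.ext <;> simp [coord, h_reR x hx]

theorem isCircularOpen_circ {E : Set ℂ} (hE : IsOpen E) (hconj : ∀ z ∈ E, conj z ∈ E) :
    IsCircularOpen (circ (A := A) E) := by
  have hc : IsCircular (circ (A := A) E) := ⟨E, rfl⟩
  obtain ⟨U, hU, h_preimage⟩ := continuousOn_iff'.1 (continuousOn_coord (A := A)) E hE
  refine ⟨hc, U, hU, ?_⟩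
  rw [← h_preimage]
  ext x
  constructor
  · intro hx
    exact ⟨sliceDom_circ (A := A) hconj ▸ hc.coord_mem hx, hc.subset_quadCone hx⟩
  · rintro ⟨hx, hq⟩
    exact (hc.coord_mem_iff hq).1 (by rwa [sliceDom_circ hconj])

end CircularSets

/-! ### The complexified algebra -/

section Complexified

variable {A : Type*} [NormedStarAlg A]

/-- The value at `J` of the element `p + ι q` of `A_ℂ`, namely `p + J q`. -/
def ev (J : A) (p : A × A) : A := p.1 + J * p.2

/-- The map `x ↦ (x - ι J x) / 2` from `A`, with the complex structure given by left multiplication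
by `J`, to `A_ℂ`; it is a right inverse of `ev J` and splits `A_ℂ` into the eigenspaces of `J` and
`-J`, see `eps_ev_add`. -/
def eps (J x : A) : A × A := ((1 / 2 : ℝ) • x, -((1 / 2 : ℝ) • (J * x)))

theorem csmul_one (p : A × A) : csmul 1 p = p := by simp [csmul]

theorem csmul_csmul (u v : ℂ) (p : A × A) : csmul u (csmul v p) = csmul (u * v) p := by
  ext <;> simp only [csmul, Complex.mul_re, Complex.mul_im] <;> module

theorem cmul_csmul (u : ℂ) (p q : A × A) : cmul p (csmul u q) = csmul u (cmul p q) := by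
  ext <;> simp only [csmul, cmul, mul_sub, mul_add, mul_smul_A] <;> module

theorem csmul_cmul (u : ℂ) (p q : A × A) : cmul (csmul u p) q = csmul u (cmul p q) := by
  ext <;> simp only [csmul, cmul, sub_mul, add_mul, smul_mul_A] <;> module

theorem cmul_add (p q r : A × A) : cmul p (q + r) = cmul p q + cmul p r := by
  ext <;> simp only [cmul, mul_add, Prod.fst_add, Prod.snd_add] <;> abel

theorem add_cmul (p q r : A × A) : cmul (p + q) r = cmul p r + cmul q r := by
  ext <;> simp only [cmul, add_mul, Prod.fst_add, Prod.snd_add] <;> abel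

theorem cstar_csmul (u : ℂ) (p : A × A) : cstar (csmul u p) = csmul u (cstar p) := by
  ext <;> simp only [csmul, cstar, star_sub, star_add, star_smul_A]

theorem cstar_cstar (p : A × A) : cstar (cstar p) = p := by
  simp only [cstar, star_star]

theorem cconj_csmul (u : ℂ) (p : A × A) : cconj (csmul u p) = csmul (conj u) (cconj p) := by
  ext <;> simp only [csmul, cconj, Complex.conj_re, Complex.conj_im] <;> module

theorem cconj_cmul (p q : A × A) : cconj (cmul p q) = cmul (cconj p) (cconj q) := by
  ext <;> simp only [cmul, cconj, neg_mul, mul_neg, neg_neg, neg_add_rev]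
  abel

theorem cconj_cstar (p : A × A) : cconj (cstar p) = cstar (cconj p) := by
  simp only [cstar, cconj, star_neg]

theorem add_csmul_I_eq_zero_iff {p q : A × A} :
    p + csmul Complex.I q = 0 ↔ q = csmul Complex.I p := by
  simp only [csmul, Prod.ext_iff, Complex.I_re, Complex.I_im, zero_smul, one_smul, zero_sub,
    zero_add, Prod.fst_add, Prod.snd_add, Prod.fst_zero, Prod.snd_zero]
  rw [add_comm p.2, add_neg_eq_zero, add_eq_zero_iff_eq_neg, eq_comm (a := p.1), and_comm]

theorem csmul_one_eq (u : ℂ) : csmul u ((1 : A), (0 : A)) = (u.re • (1 : A), u.im • (1 : A)) := by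
  ext <;> simp [csmul]

theorem ev_csmul_one (J : A) (u : ℂ) : ev J (csmul u ((1 : A), (0 : A))) = pt J u := by
  rw [csmul_one_eq, ev, mul_smul_A, mul_one, pt]

variable [IsSliceAlg A]

theorem ev_csmul {J : A} (hJ : J ∈ imagUnits A) (u : ℂ) (p : A × A) :
    ev J (csmul u p) = pt J u * ev J p := by
  simp only [ev, csmul, pt_mul_apply, mul_add, mul_smul_A, unit_mul_unit_mul hJ]
  module

theorem eps_pt_mul {J : A} (hJ : J ∈ imagUnits A) (u : ℂ) (x : A) :
    eps J (pt J u * x) = csmul u (eps J x) := by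
  ext <;> simp only [eps, csmul, pt_mul_apply, mul_add, mul_smul_A, unit_mul_unit_mul hJ] <;>
    module

theorem eps_ev_add {J : A} (hJ : J ∈ imagUnits A) (p : A × A) :
    eps J (ev J p) + eps (-J) (ev (-J) p) = p := by
  ext <;> simp only [eps, ev, Prod.fst_add, Prod.snd_add, mul_add, neg_mul, mul_neg,
    unit_mul_unit_mul hJ] <;> module

theorem ev_cmul_pt {J : A} (hJ : J ∈ imagUnits A) (u v : ℂ) (q : A × A) :
    ev J (cmul (pt J u, pt J v) q) = pt J (u + Complex.I * v) * ev J q := by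
  simp only [ev, cmul, pt_mul_apply, mul_add, mul_smul_A, unit_mul_unit_mul hJ,
    Complex.add_re, Complex.add_im, Complex.mul_re, Complex.mul_im, Complex.I_re, Complex.I_im]
  module

variable (A) in
/-- A real linear functional on `A` with value `1` at the unit. -/
def oneFunctional : StrongDual ℝ A :=
  (SeparatingDual.exists_eq_one (R := ℝ) (IsSliceAlg.one_ne_zero (A := A))).choose

theorem oneFunctional_one : oneFunctional A 1 = 1 :=
  (SeparatingDual.exists_eq_one (R := ℝ) (IsSliceAlg.one_ne_zero (A := A))).choose_spec

/-- The complexification of `oneFunctional`: it reads off `u` from the element `u · 1` of `A_ℂ`,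
`u ∈ ℝ + ι ℝ ≃ ℂ`. -/
def scal : A × A →ₗ[ℝ] ℂ where
  toFun p := ⟨oneFunctional A p.1, oneFunctional A p.2⟩
  map_add' p q := by apply Complex.ext <;> simp
  map_smul' r p := by apply Complex.ext <;> simp

theorem scal_apply (p : A × A) : scal p = ⟨oneFunctional A p.1, oneFunctional A p.2⟩ := rfl

theorem scal_csmul (u : ℂ) (p : A × A) : scal (csmul u p) = u * scal p := by
  apply Complex.ext <;> simp [scal_apply, csmul, Complex.mul_re, Complex.mul_im]

theorem scal_csmul_one (u : ℂ) : scal (csmul u ((1 : A), (0 : A))) = u := by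
  have h_one : scal ((1 : A), (0 : A)) = 1 := by
    apply Complex.ext <;> simp [scal_apply, oneFunctional_one]
  rw [scal_csmul, h_one, mul_one]

theorem scal_cconj (p : A × A) : scal (cconj p) = conj (scal p) := by
  apply Complex.ext <;> simp [scal_apply, cconj]

end Complexified

/-! ### Slice functions and the reciprocal of a tame function -/

section SliceFunctions

variable {A : Type*} [NormedStarAlg A]

/-- The domain of the reciprocal `f^{-•}` of a function `f` on `Ω`. -/
def invDomain (Ω : Set A) (f : A → A) : Set A := {x ∈ Ω | normalFn f x ≠ 0}

theorem invDomain_subset {Ω : Set A} {f : A → A} : invDomain Ω f ⊆ Ω := fun _ hx => hx.1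

theorem IsSlice.isCircular {Ω : Set A} {f : A → A} (h : IsSlice Ω f) : IsCircular Ω := h.2.1

theorem IsTame.isSlice {Ω : Set A} {f : A → A} (h : IsTame Ω f) : IsSlice Ω f := h.1

theorem Induces.mono {Ω Ω₁ : Set A} {F : ℂ → A × A} {f : A → A} (hf : Induces Ω F f)
    (h : Ω₁ ⊆ Ω) : Induces Ω₁ F f :=
  fun z hz => hf z (sliceDom_mono h hz)

section IsStem

variable {D D' : Set ℂ} {F G : ℂ → A × A}

theorem IsStem.mono (hF : IsStem D F) (h : D' ⊆ D) : IsStem D' F := fun z hz => hF z (h hz)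

theorem isStem_const_real (D : Set ℂ) (a : A) : IsStem D (fun _ => (a, (0 : A))) := by
  intro z _
  simp only [cconj, neg_zero]

theorem isStem_cmul (hF : IsStem D F) (hG : IsStem D G) : IsStem D (fun z => cmul (F z) (G z)) := by
  intro z hz
  simp only [hF z hz, hG z hz, cconj_cmul]

theorem isStem_cstar (hF : IsStem D F) : IsStem D (fun z => cstar (F z)) := by
  intro z hz
  simp only [hF z hz, cconj_cstar]

theorem isStem_csmul {u : ℂ → ℂ} (hu : ∀ z ∈ D, u (conj z) = conj (u z)) (hF : IsStem D F) :
    IsStem D (fun z => csmul (u z) (F z)) := by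
  intro z hz
  simp only [hF z hz, hu z hz, cconj_csmul]

end IsStem

variable [IsSliceAlg A] {Ω : Set A} {f g : A → A}

theorem stem_congr (hc : IsCircular Ω) (h : ∀ x ∈ Ω, f x = g x) {z : ℂ} (hz : z ∈ sliceDom Ω) :
    stem f z = stem g z := by
  have h_pt := h _ ((hc.pt_mem_iff someUnit_mem).2 hz)
  have h_pt_conj := h _ ((hc.pt_mem_iff someUnit_mem).2 (hc.conj_mem hz))
  simp only [stem, h_pt, h_pt_conj]

theorem stem_eq_of_induces (hc : IsCircular Ω) {F : ℂ → A × A} (hF : IsStem (sliceDom Ω) F)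
    (hf : Induces Ω F f) {z : ℂ} (hz : z ∈ sliceDom Ω) : stem f z = F z :=
  stem_eq hF (fun _ => hc.conj_mem) hf hz

theorem stem_ind (hc : IsCircular Ω) {F : ℂ → A × A} (hF : IsStem (sliceDom Ω) F) {z : ℂ}
    (hz : z ∈ sliceDom Ω) : stem (ind F) z = F z :=
  stem_eq_of_induces hc hF (induces_ind hF) hz

theorem IsSlice.isStem_stem (h : IsSlice Ω f) : IsStem (sliceDom Ω) (stem f) := by
  obtain ⟨-, hc, F, hF, hf⟩ := h
  intro z hz
  rw [stem_eq_of_induces hc hF hf hz, stem_eq_of_induces hc hF hf (IsCircular.conj_mem hc hz),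
    hF z hz]

theorem IsSlice.induces_stem (h : IsSlice Ω f) : Induces Ω (stem f) f := by
  obtain ⟨-, hc, F, hF, hf⟩ := h
  intro z hz
  rw [stem_eq_of_induces hc hF hf hz]
  exact hf z hz

theorem IsSlice.stem_sliceConj (h : IsSlice Ω f) {z : ℂ} (hz : z ∈ sliceDom Ω) :
    stem (sliceConj f) z = cstar (stem f z) :=
  stem_ind h.isCircular (isStem_cstar h.isStem_stem) hz

theorem IsSlice.isSlice_sliceConj (h : IsSlice Ω f) : IsSlice Ω (sliceConj f) :=
  ⟨h.1, h.2.1, _, isStem_cstar h.isStem_stem, induces_ind (isStem_cstar h.isStem_stem)⟩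

theorem IsSlice.isSlice_sliceMul (hf : IsSlice Ω f) (hg : IsSlice Ω g) : IsSlice Ω (sliceMul f g) :=
  ⟨hf.1, hf.2.1, _, isStem_cmul hf.isStem_stem hg.isStem_stem,
    induces_ind (isStem_cmul hf.isStem_stem hg.isStem_stem)⟩

theorem IsSlice.isSlice_normalFn (h : IsSlice Ω f) : IsSlice Ω (normalFn f) :=
  h.isSlice_sliceMul h.isSlice_sliceConj

theorem IsSlice.stem_normalFn (h : IsSlice Ω f) {z : ℂ} (hz : z ∈ sliceDom Ω) :
    stem (normalFn f) z = cmul (stem f z) (cstar (stem f z)) := by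
  rw [← h.stem_sliceConj hz]
  exact stem_ind h.isCircular (isStem_cmul h.isStem_stem h.isSlice_sliceConj.isStem_stem) hz

theorem IsSlice.isTame_of_cmul_cstar (h : IsSlice Ω f) {u : ℂ → ℂ}
    (hu : ∀ z ∈ sliceDom Ω, cmul (stem f z) (cstar (stem f z)) = csmul (u z) (1, 0))
    (hu' : ∀ z ∈ sliceDom Ω, cmul (cstar (stem f z)) (stem f z) = csmul (u z) (1, 0)) :
    IsTame Ω f := by
  have h_stem : ∀ z ∈ sliceDom Ω, stem (normalFn f) z = stem (normalFn (sliceConj f)) z := by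
    intro z hz
    rw [h.stem_normalFn hz, h.isSlice_sliceConj.stem_normalFn hz, h.stem_sliceConj hz, cstar_cstar,
      hu z hz, hu' z hz]
  refine ⟨h, ⟨h.1, h.2.1, _, h.isSlice_normalFn.isStem_stem, h.isSlice_normalFn.induces_stem,
    fun z hz => ⟨(u z).re, (u z).im, ?_⟩⟩, fun x hx => ?_⟩
  · rw [h.stem_normalFn hz, hu z hz, csmul_one_eq]
  · obtain ⟨J, hJ, hx_eq⟩ := exists_eq_pt_coord (h.isCircular.subset_quadCone hx)
    have hz := h.isCircular.coord_mem hx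
    rw [hx_eq, h.isSlice_normalFn.induces_stem _ hz J hJ,
      h.isSlice_sliceConj.isSlice_normalFn.induces_stem _ hz J hJ, h_stem _ hz]

/-- The stem function of `N(f)` for tame `f`, as a complex function. -/
def normStem (f : A → A) (z : ℂ) : ℂ := scal (cmul (stem f z) (cstar (stem f z)))

/-- The stem function of the reciprocal `f^{-•}` of a tame function. -/
def invStem (f : A → A) (z : ℂ) : A × A := csmul (normStem f z)⁻¹ (cstar (stem f z))

theorem IsTame.cmul_cstar (h : IsTame Ω f) {z : ℂ} (hz : z ∈ sliceDom Ω) :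
    cmul (stem f z) (cstar (stem f z)) = csmul (normStem f z) (1, 0) := by
  obtain ⟨hs, ⟨-, hc, F, hF, hi, hreal⟩, -⟩ := h
  obtain ⟨a, b, hab⟩ := hreal z hz
  have h_eq : cmul (stem f z) (cstar (stem f z)) = csmul ⟨a, b⟩ (1, 0) := by
    rw [← hs.stem_normalFn hz, stem_eq_of_induces hc hF hi hz, hab, csmul_one_eq]
  rw [normStem, h_eq, scal_csmul_one]

theorem IsTame.cstar_cmul (h : IsTame Ω f) {z : ℂ} (hz : z ∈ sliceDom Ω) :
    cmul (cstar (stem f z)) (stem f z) = csmul (normStem f z) (1, 0) := by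
  have hs := h.isSlice
  rw [← h.cmul_cstar hz, ← hs.stem_normalFn hz, stem_congr hs.isCircular h.2.2 hz,
    hs.isSlice_sliceConj.stem_normalFn hz, hs.stem_sliceConj hz, cstar_cstar]

theorem IsTame.stem_normalFn (h : IsTame Ω f) {z : ℂ} (hz : z ∈ sliceDom Ω) :
    stem (normalFn f) z = csmul (normStem f z) (1, 0) := by
  rw [h.isSlice.stem_normalFn hz, h.cmul_cstar hz]

theorem IsTame.normStem_conj (h : IsTame Ω f) {z : ℂ} (hz : z ∈ sliceDom Ω) :
    normStem f (conj z) = conj (normStem f z) := by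
  have h_stem := h.isSlice.isSlice_normalFn.isStem_stem z hz
  rw [h.stem_normalFn hz, h.stem_normalFn (h.isSlice.isCircular.conj_mem hz)] at h_stem
  rw [← scal_csmul_one (A := A) (normStem f (conj z)), h_stem, scal_cconj, scal_csmul_one]

theorem IsTame.normalFn_pt (h : IsTame Ω f) {J : A} (hJ : J ∈ imagUnits A) {z : ℂ}
    (hz : z ∈ sliceDom Ω) : normalFn f (pt J z) = pt J (normStem f z) := by
  rw [h.isSlice.isSlice_normalFn.induces_stem z hz J hJ, h.stem_normalFn hz]
  exact ev_csmul_one J _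

theorem IsTame.isStem_invStem (h : IsTame Ω f) : IsStem (sliceDom Ω) (invStem f) :=
  isStem_csmul (fun z hz => by rw [h.normStem_conj hz, map_inv₀]) (isStem_cstar h.1.isStem_stem)

theorem IsTame.induces_invStem (h : IsTame Ω f) : Induces Ω (invStem f) (sliceInv f) := by
  intro z hz J hJ
  have h_conj : sliceConj f (pt J z) = ev J (cstar (stem f z)) :=
    induces_ind (isStem_cstar h.1.isStem_stem) z hz J hJ
  rw [sliceInv, h.normalFn_pt hJ hz, coneInv_pt hJ, h_conj, ← ev_csmul hJ, invStem, ev]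

theorem IsTame.stem_sliceInv (h : IsTame Ω f) {z : ℂ} (hz : z ∈ sliceDom Ω) :
    stem (sliceInv f) z = invStem f z :=
  stem_eq_of_induces h.isSlice.isCircular h.isStem_invStem h.induces_invStem hz

theorem IsTame.invDomain_eq_circ (h : IsTame Ω f) :
    invDomain Ω f = circ {z ∈ sliceDom Ω | normStem f z ≠ 0} := by
  have hc := h.isSlice.isCircular
  have h_ne : ∀ {J : A} {z : ℂ}, J ∈ imagUnits A → z ∈ sliceDom Ω →
      (normalFn f (pt J z) ≠ 0 ↔ normStem f z ≠ 0) := fun hJ hz => by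
    rw [h.normalFn_pt hJ hz, Ne, pt_eq_zero_iff hJ]
  ext x
  constructor
  · rintro ⟨hx, hne⟩
    obtain ⟨J, hJ, hx_eq⟩ := exists_eq_pt_coord (hc.subset_quadCone hx)
    have hz := hc.coord_mem hx
    exact ⟨_, ⟨hz, (h_ne hJ hz).1 (hx_eq ▸ hne)⟩, J, hJ, hx_eq⟩
  · rintro ⟨z, ⟨hz, hne⟩, J, hJ, rfl⟩
    exact ⟨(hc.pt_mem_iff hJ).2 hz, (h_ne hJ hz).2 hne⟩

theorem IsTame.isCircular_invDomain (h : IsTame Ω f) : IsCircular (invDomain Ω f) :=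
  ⟨_, h.invDomain_eq_circ⟩

theorem IsTame.conj_mem_setOf_normStem_ne_zero (h : IsTame Ω f) :
    ∀ z ∈ {z ∈ sliceDom Ω | normStem f z ≠ 0}, conj z ∈ {z ∈ sliceDom Ω | normStem f z ≠ 0} := by
  rintro z ⟨hz, hne⟩
  refine ⟨h.isSlice.isCircular.conj_mem hz, ?_⟩
  rwa [h.normStem_conj hz, Ne, map_eq_zero]

theorem IsTame.sliceDom_invDomain (h : IsTame Ω f) :
    sliceDom (invDomain Ω f) = {z ∈ sliceDom Ω | normStem f z ≠ 0} := by
  rw [h.invDomain_eq_circ, sliceDom_circ h.conj_mem_setOf_normStem_ne_zero]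

theorem IsTame.isSlice_sliceInv (h : IsTame Ω f) (hne : (invDomain Ω f).Nonempty) :
    IsSlice (invDomain Ω f) (sliceInv f) :=
  ⟨hne, h.isCircular_invDomain, invStem f, h.isStem_invStem.mono (sliceDom_mono invDomain_subset),
    h.induces_invStem.mono invDomain_subset⟩

theorem IsTame.cmul_invStem (h : IsTame Ω f) {z : ℂ} (hz : z ∈ sliceDom Ω)
    (hne : normStem f z ≠ 0) : cmul (stem f z) (invStem f z) = (1, 0) := by
  rw [invStem, cmul_csmul, h.cmul_cstar hz, csmul_csmul, inv_mul_cancel₀ hne, csmul_one]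

theorem IsTame.invStem_cmul (h : IsTame Ω f) {z : ℂ} (hz : z ∈ sliceDom Ω)
    (hne : normStem f z ≠ 0) : cmul (invStem f z) (stem f z) = (1, 0) := by
  rw [invStem, csmul_cmul, h.cstar_cmul hz, csmul_csmul, inv_mul_cancel₀ hne, csmul_one]

theorem IsTame.sliceMul_sliceInv (h : IsTame Ω f) {x : A} (hx : x ∈ invDomain Ω f) :
    sliceMul f (sliceInv f) x = 1 ∧ sliceMul (sliceInv f) f x = 1 := by
  have hz := h.isCircular_invDomain.coord_mem hx
  rw [h.sliceDom_invDomain] at hz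
  simp only [sliceMul, ind, h.stem_sliceInv hz.1, h.cmul_invStem hz.1 hz.2,
    h.invStem_cmul hz.1 hz.2, mul_zero, add_zero, and_self]

theorem IsTame.cmul_cstar_invStem (h : IsTame Ω f) {z : ℂ} (hz : z ∈ sliceDom Ω)
    (hne : normStem f z ≠ 0) :
    cmul (invStem f z) (cstar (invStem f z)) = csmul (normStem f z)⁻¹ (1, 0) := by
  rw [invStem, cstar_csmul, cstar_cstar, cmul_csmul, csmul_cmul, h.cstar_cmul hz, csmul_csmul,
    csmul_csmul, mul_assoc, inv_mul_cancel₀ hne, mul_one]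

theorem IsTame.cstar_cmul_invStem (h : IsTame Ω f) {z : ℂ} (hz : z ∈ sliceDom Ω)
    (hne : normStem f z ≠ 0) :
    cmul (cstar (invStem f z)) (invStem f z) = csmul (normStem f z)⁻¹ (1, 0) := by
  rw [invStem, cstar_csmul, cstar_cstar, cmul_csmul, csmul_cmul, h.cmul_cstar hz, csmul_csmul,
    csmul_csmul, mul_assoc, inv_mul_cancel₀ hne, mul_one]

theorem IsTame.isTame_sliceInv (h : IsTame Ω f) (hne : (invDomain Ω f).Nonempty) :
    IsTame (invDomain Ω f) (sliceInv f) := by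
  refine (h.isSlice_sliceInv hne).isTame_of_cmul_cstar (u := fun z => (normStem f z)⁻¹) ?_ ?_
  all_goals
    intro z hz
    rw [h.sliceDom_invDomain] at hz
    rw [h.stem_sliceInv hz.1]
  · exact h.cmul_cstar_invStem hz.1 hz.2
  · exact h.cstar_cmul_invStem hz.1 hz.2

end SliceFunctions

/-! ### Complex coordinates on `A_ℂ` -/

section CoordSpace

variable (A : Type*) [NormedStarAlg A] in
/-- The complex coordinate space of `A_ℂ`. -/
abbrev CoordSpace : Type := Fin (Module.finrank ℝ A) → ℂ

variable {A : Type*} [NormedStarAlg A] [FiniteDimensional ℝ A]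

/-- The real linear isomorphism underlying `toCoord`. -/
def toCoordₗ : (A × A) ≃ₗ[ℝ] CoordSpace A where
  toFun p := fun i => ⟨(Module.finBasis ℝ A).equivFun p.1 i, (Module.finBasis ℝ A).equivFun p.2 i⟩
  invFun v := ((Module.finBasis ℝ A).equivFun.symm fun i => (v i).re,
    (Module.finBasis ℝ A).equivFun.symm fun i => (v i).im)
  map_add' p q := by ext i; apply Complex.ext <;> simp
  map_smul' r p := by ext i; apply Complex.ext <;> simp
  left_inv p := by ext <;> simp
  right_inv v := by
    ext i
    apply Complex.ext <;> simp only [LinearEquiv.apply_symm_apply]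

/-- Complex coordinates on `A_ℂ` with respect to a real basis of `A`. They turn `csmul` into scalar
multiplication, so that stem functions annihilated by `dbar` become holomorphic maps. -/
def toCoord : (A × A) ≃L[ℝ] CoordSpace A := toCoordₗ.toContinuousLinearEquiv

theorem toCoord_apply (p : A × A) (i : Fin (Module.finrank ℝ A)) : toCoord p i =
    ⟨(Module.finBasis ℝ A).equivFun p.1 i, (Module.finBasis ℝ A).equivFun p.2 i⟩ := rfl

theorem toCoord_csmul (u : ℂ) (p : A × A) : toCoord (csmul u p) = u • toCoord p := by
  ext i
  apply Complex.ext <;> simp [toCoord_apply, csmul]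

theorem toCoord_symm_smul (u : ℂ) (v : CoordSpace A) :
    toCoord.symm (u • v) = csmul u (toCoord.symm v) := by
  rw [ContinuousLinearEquiv.symm_apply_eq, toCoord_csmul, ContinuousLinearEquiv.apply_symm_apply]

theorem toCoord_cconj (p : A × A) : toCoord (cconj p) = star (toCoord p) := by
  ext i
  rw [Pi.star_apply]
  apply Complex.ext <;> simp [toCoord_apply, cconj]

theorem toCoord_symm_fst (v : CoordSpace A) :
    toCoord ((toCoord.symm v).1, 0) = (1 / 2 : ℂ) • (v + star v) := by
  obtain ⟨p, rfl⟩ := toCoord.surjective v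
  rw [← toCoord_cconj, ← map_add, ← toCoord_csmul, ContinuousLinearEquiv.symm_apply_apply]
  congr 1
  ext
  · simp only [csmul, cconj, Prod.fst_add, Prod.snd_add]
    norm_num
    module
  · simp [csmul, cconj]

section Descend

variable {W : Type*} [NormedAddCommGroup W] [NormedSpace ℂ W]

/-- The complex linear map on coordinates induced by a real linear map on `A_ℂ` which commutes with
`csmul`. -/
def descend (T : A × A →ₗ[ℝ] W) (hT : ∀ (u : ℂ) (p : A × A), T (csmul u p) = u • T p) :
    CoordSpace A →L[ℂ] W :=
  LinearMap.toContinuousLinearMap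
    { toFun := fun v => T (toCoord.symm v)
      map_add' := fun v w => by rw [map_add, map_add]
      map_smul' := fun u v => by rw [toCoord_symm_smul, hT, RingHom.id_apply] }

theorem descend_toCoord (T : A × A →ₗ[ℝ] W)
    (hT : ∀ (u : ℂ) (p : A × A), T (csmul u p) = u • T p) (p : A × A) :
    descend T hT (toCoord p) = T p :=
  congrArg T (toCoord.symm_apply_apply p)

end Descend

/-- The involution of `A_ℂ` in coordinates. -/
def cstarCoord : CoordSpace A →L[ℂ] CoordSpace A :=
  descend
    { toFun := fun p => toCoord (cstar p)
      map_add' := fun p q => by rw [← map_add]; congr 1; ext <;> simp [cstar]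
      map_smul' := fun r p => by
        rw [RingHom.id_apply, ← map_smul]; congr 1; ext <;> simp [cstar, star_smul_A] }
    fun u p => (congrArg toCoord (cstar_csmul u p)).trans (toCoord_csmul u (cstar p))

theorem cstarCoord_toCoord (p : A × A) : cstarCoord (toCoord p) = toCoord (cstar p) :=
  descend_toCoord _ _ p

/-- The product of `A_ℂ` in coordinates. -/
def mulCoord : CoordSpace A →L[ℂ] CoordSpace A →L[ℂ] CoordSpace A :=
  LinearMap.toContinuousBilinearMap <|
    LinearMap.mk₂ ℂ (fun v w => toCoord (cmul (toCoord.symm v) (toCoord.symm w)))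
      (fun v v' w => by rw [map_add, add_cmul, map_add])
      (fun u v w => by rw [toCoord_symm_smul, csmul_cmul, toCoord_csmul])
      (fun v w w' => by rw [map_add, cmul_add, map_add])
      (fun u v w => by rw [toCoord_symm_smul, cmul_csmul, toCoord_csmul])

theorem mulCoord_toCoord (p q : A × A) :
    mulCoord (toCoord p) (toCoord q) = toCoord (cmul p q) := by
  change toCoord (cmul (toCoord.symm (toCoord p)) (toCoord.symm (toCoord q))) = _
  rw [ContinuousLinearEquiv.symm_apply_apply, ContinuousLinearEquiv.symm_apply_apply]

/-- The map `ev J` in coordinates. -/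
def evCoord (J : A) : CoordSpace A →L[ℝ] A :=
  LinearMap.toContinuousLinearMap
    { toFun := fun v => ev J (toCoord.symm v)
      map_add' := fun v w => by simp only [map_add, ev, Prod.fst_add, Prod.snd_add, mul_add]; abel
      map_smul' := fun r v => by
        simp only [map_smul, ev, Prod.smul_fst, Prod.smul_snd, mul_smul_A, smul_add,
          RingHom.id_apply] }

theorem evCoord_toCoord (J : A) (p : A × A) : evCoord J (toCoord p) = ev J p :=
  congrArg (ev J) (toCoord.symm_apply_apply p)

/-- The map `eps J` in coordinates. -/
def epsCoord (J : A) : A →L[ℝ] CoordSpace A :=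
  LinearMap.toContinuousLinearMap
    { toFun := fun x => toCoord (eps J x)
      map_add' := fun x y => by
        rw [← map_add]; congr 1
        ext <;> simp only [eps, mul_add, Prod.fst_add, Prod.snd_add] <;> module
      map_smul' := fun r x => by
        rw [RingHom.id_apply, ← map_smul]; congr 1
        ext <;> simp only [eps, mul_smul_A, Prod.smul_fst, Prod.smul_snd] <;> module }

theorem epsCoord_apply (J : A) (x : A) : epsCoord J x = toCoord (eps J x) := rfl

/-- The stem function of `f` in complex coordinates. -/
def stemCoord (f : A → A) (z : ℂ) : CoordSpace A := toCoord (stem f z)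

theorem dbar_eq_zero_iff {F : ℂ → A × A} {z : ℂ} (hF : DifferentiableAt ℝ F z) :
    dbar F z = 0 ↔ DifferentiableAt ℂ (fun z => toCoord (F z)) z := by
  have h_fderiv : fderiv ℝ (fun z => toCoord (F z)) z =
      ((toCoord : (A × A) ≃L[ℝ] CoordSpace A) : (A × A) →L[ℝ] CoordSpace A).comp
        (fderiv ℝ F z) :=
    (toCoord : (A × A) ≃L[ℝ] CoordSpace A).comp_fderiv
  have h_diff : DifferentiableAt ℝ (fun z => toCoord (F z)) z :=
    (toCoord : (A × A) ≃L[ℝ] CoordSpace A).differentiableAt.comp z hF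
  rw [differentiableAt_complex_iff_differentiableAt_real, and_iff_right h_diff, h_fderiv,
    ContinuousLinearMap.comp_apply, ContinuousLinearMap.comp_apply, ContinuousLinearEquiv.coe_coe,
    ← toCoord_csmul, toCoord.injective.eq_iff, dbar, smul_eq_zero_iff_right (by norm_num),
    add_csmul_I_eq_zero_iff]

end CoordSpace

section SliceRegular

variable {A : Type*} [NormedStarAlg A]

theorem IsSliceRegular.isSlice {Ω : Set A} {f : A → A} (h : IsSliceRegular Ω f) : IsSlice Ω f := by
  obtain ⟨hne, ho, F, hF, hi, -⟩ := h
  exact ⟨hne, ho.1, F, hF, hi⟩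

variable [IsSliceAlg A]

attribute [local instance] IsSliceAlg.finiteDimensional

/-- The functional `scal` in coordinates. -/
def scalCoord : CoordSpace A →L[ℂ] ℂ := descend scal scal_csmul

theorem evCoord_smul {J : A} (hJ : J ∈ imagUnits A) (u : ℂ) (v : CoordSpace A) :
    evCoord J (u • v) = pt J u * evCoord J v := by
  obtain ⟨p, rfl⟩ := toCoord.surjective v
  rw [← toCoord_csmul, evCoord_toCoord, evCoord_toCoord, ev_csmul hJ]

theorem epsCoord_pt_mul {J : A} (hJ : J ∈ imagUnits A) (u : ℂ) (x : A) :
    epsCoord J (pt J u * x) = u • epsCoord J x := by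
  rw [epsCoord_apply, eps_pt_mul hJ, toCoord_csmul, epsCoord_apply]

theorem epsCoord_evCoord_add {J : A} (hJ : J ∈ imagUnits A) (v : CoordSpace A) :
    epsCoord J (evCoord J v) + epsCoord (-J) (evCoord (-J) v) = v := by
  obtain ⟨p, rfl⟩ := toCoord.surjective v
  rw [evCoord_toCoord, evCoord_toCoord, epsCoord_apply, epsCoord_apply, ← map_add, eps_ev_add hJ]

theorem normStem_eq (f : A → A) (z : ℂ) :
    normStem f z = scalCoord (mulCoord (stemCoord f z) (cstarCoord (stemCoord f z))) := by
  rw [stemCoord, cstarCoord_toCoord, mulCoord_toCoord]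
  exact (descend_toCoord scal scal_csmul _).symm

theorem IsTame.stemCoord_sliceInv {Ω : Set A} {f : A → A} (h : IsTame Ω f) {z : ℂ}
    (hz : z ∈ sliceDom Ω) :
    stemCoord (sliceInv f) z = (normStem f z)⁻¹ • cstarCoord (stemCoord f z) := by
  rw [stemCoord, h.stem_sliceInv hz, invStem, toCoord_csmul, stemCoord, cstarCoord_toCoord]

theorem IsSlice.stemCoord_conj {Ω : Set A} {f : A → A} (h : IsSlice Ω f) {z : ℂ}
    (hz : z ∈ sliceDom Ω) : stemCoord f (conj z) = star (stemCoord f z) := by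
  rw [stemCoord, h.isStem_stem z hz, toCoord_cconj, stemCoord]

theorem IsSlice.evCoord_stemCoord {Ω : Set A} {f : A → A} (h : IsSlice Ω f) {J : A}
    (hJ : J ∈ imagUnits A) {z : ℂ} (hz : z ∈ sliceDom Ω) :
    evCoord J (stemCoord f z) = f (pt J z) := by
  rw [stemCoord, evCoord_toCoord, h.induces_stem z hz J hJ, ev]

theorem IsSlice.stemCoord_eq_add {Ω : Set A} {f : A → A} (h : IsSlice Ω f) {J : A}
    (hJ : J ∈ imagUnits A) {z : ℂ} (hz : z ∈ sliceDom Ω) :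
    stemCoord f z = epsCoord J (f (pt J z)) + epsCoord (-J) (f (pt (-J) z)) := by
  rw [← h.evCoord_stemCoord hJ hz, ← h.evCoord_stemCoord (neg_mem_imagUnits hJ) hz,
    epsCoord_evCoord_add hJ]

theorem IsSliceRegular.differentiableOn_stemCoord {Ω : Set A} {f : A → A}
    (h : IsSliceRegular Ω f) : DifferentiableOn ℂ (stemCoord f) (sliceDom Ω) := by
  obtain ⟨-, ho, F, hF, hi, hd, h_dbar⟩ := h
  have hF_diff : DifferentiableOn ℂ (fun z => toCoord (F z)) (sliceDom Ω) := fun z hz =>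
    ((dbar_eq_zero_iff ((hd.differentiableOn one_ne_zero).differentiableAt
      (ho.isOpen_sliceDom.mem_nhds hz))).1 (h_dbar z hz)).differentiableWithinAt
  exact hF_diff.congr fun z hz => congrArg toCoord (stem_eq_of_induces ho.1 hF hi hz)

theorem IsSliceRegular.analyticAt_stemCoord {Ω : Set A} {f : A → A} (h : IsSliceRegular Ω f)
    {z : ℂ} (hz : z ∈ sliceDom Ω) : AnalyticAt ℂ (stemCoord f) z :=
  h.differentiableOn_stemCoord.analyticAt (h.2.1.isOpen_sliceDom.mem_nhds hz)

theorem IsSlice.isSliceRegular {Ω : Set A} {f : A → A} (h : IsSlice Ω f) (ho : IsCircularOpen Ω)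
    (hd : DifferentiableOn ℂ (stemCoord f) (sliceDom Ω)) : IsSliceRegular Ω f := by
  have hD := ho.isOpen_sliceDom
  have h_cont : ContDiffOn ℝ 1 (stem f) (sliceDom Ω) := by
    refine (toCoord.symm.contDiff.comp_contDiffOn
      ((hd.contDiffOn hD).restrict_scalars ℝ)).congr fun z _ => ?_
    rw [Function.comp_apply, stemCoord, ContinuousLinearEquiv.symm_apply_apply]
  refine ⟨h.1, ho, stem f, h.isStem_stem, h.induces_stem, h_cont, fun z hz => ?_⟩
  exact (dbar_eq_zero_iff ((h_cont.differentiableOn one_ne_zero).differentiableAt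
    (hD.mem_nhds hz))).2 (hd.differentiableAt (hD.mem_nhds hz))

end SliceRegular

/-! ### Poles and expansions of vector-valued functions -/

theorem exists_shifted_coeff {E : Type*} [Zero E] (k : ℕ) (v : ℕ → E) :
    ∃ b : ℤ → E, (∀ n < -(k : ℤ), b n = 0) ∧ ∀ j : ℕ, b (j - k) = v j := by
  have h_inj : Function.Injective fun j : ℕ => (j : ℤ) - k := fun i j h => by
    simpa only [sub_left_inj, Nat.cast_inj] using h
  refine ⟨Function.extend (fun j : ℕ => (j : ℤ) - k) v 0, fun n hn => ?_, fun j =>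
    h_inj.extend_apply v 0 j⟩
  refine Function.extend_apply' _ _ _ ?_
  rintro ⟨j, hj⟩
  exact absurd hn (by simp only [← hj]; omega)

section Poles

variable {E W : Type*} [NormedAddCommGroup E] [NormedSpace ℂ E] [NormedAddCommGroup W]
  [NormedSpace ℂ W] {F G : ℂ → E} {k l : ℕ} {z₀ : ℂ}

/-- At `z₀` the function `F` has a removable singularity or a pole of order at most `k`. -/
def HasPoleLE (k : ℕ) (F : ℂ → E) (z₀ : ℂ) : Prop :=
  ∃ P : ℂ → E, AnalyticAt ℂ P z₀ ∧ ∀ᶠ z in 𝓝[≠] z₀, (z - z₀) ^ k • F z = P z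

theorem HasPoleLE.meromorphicAt (h : HasPoleLE k F z₀) : MeromorphicAt F z₀ := by
  obtain ⟨P, hP, h_eq⟩ := h
  have h_mero : MeromorphicAt (fun z => ((z - z₀) ^ k)⁻¹ • P z) z₀ :=
    MeromorphicAt.smul (by fun_prop) hP.meromorphicAt
  refine h_mero.congr ?_
  filter_upwards [h_eq, self_mem_nhdsWithin] with z hz hne
  rw [← hz, inv_smul_smul₀ (pow_ne_zero k (sub_ne_zero.2 hne))]

theorem hasPoleLE_iff_meromorphicOrderAt (hF : MeromorphicAt F z₀) :
    HasPoleLE k F z₀ ↔ 0 ≤ k + meromorphicOrderAt F z₀ := by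
  have h_pow : MeromorphicAt ((· - z₀) ^ k) z₀ := by fun_prop
  rw [← meromorphicOrderAt_pow_id_sub_const (x := z₀) (n := k),
    ← meromorphicOrderAt_smul h_pow hF, (h_pow.smul hF).meromorphicOrderAt_nonneg_iff]
  rfl

theorem exists_hasPoleLE (hF : MeromorphicAt F z₀) : ∃ k, HasPoleLE k F z₀ := by
  obtain ⟨k, hk⟩ := hF
  exact ⟨k, _, hk, Eventually.of_forall fun _ => rfl⟩

theorem hasPoleLE_of_analyticAt (k : ℕ) (hF : AnalyticAt ℂ F z₀) : HasPoleLE k F z₀ :=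
  ⟨_, ((analyticAt_id.sub analyticAt_const).pow k).smul hF, Eventually.of_forall fun _ => rfl⟩

theorem hasPoleLE_inv_pow_smul (k : ℕ) (hF : AnalyticAt ℂ F z₀) :
    HasPoleLE k (fun z => ((z - z₀) ^ k)⁻¹ • F z) z₀ := by
  refine ⟨F, hF, ?_⟩
  filter_upwards [self_mem_nhdsWithin] with z hne
  rw [smul_inv_smul₀ (pow_ne_zero k (sub_ne_zero.2 hne))]

theorem HasPoleLE.congr (h : HasPoleLE k F z₀) (hFG : ∀ᶠ z in 𝓝[≠] z₀, F z = G z) :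
    HasPoleLE k G z₀ := by
  obtain ⟨P, hP, h_eq⟩ := h
  refine ⟨P, hP, ?_⟩
  filter_upwards [h_eq, hFG] with z hz hzG
  rw [← hzG, hz]

theorem HasPoleLE.add (hF : HasPoleLE k F z₀) (hG : HasPoleLE k G z₀) :
    HasPoleLE k (fun z => F z + G z) z₀ := by
  obtain ⟨P, hP, hFP⟩ := hF
  obtain ⟨Q, hQ, hGQ⟩ := hG
  refine ⟨_, hP.add hQ, ?_⟩
  filter_upwards [hFP, hGQ] with z hFz hGz
  rw [smul_add, hFz, hGz, Pi.add_apply]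

theorem HasPoleLE.clm_comp (hF : HasPoleLE k F z₀) (T : E →L[ℂ] W) :
    HasPoleLE k (fun z => T (F z)) z₀ := by
  obtain ⟨P, hP, hFP⟩ := hF
  refine ⟨_, (T.analyticAt _).comp hP, ?_⟩
  filter_upwards [hFP] with z hz
  rw [← map_smul, hz, Function.comp_apply]

theorem HasPoleLE.inv_smul (hF : HasPoleLE k F z₀) {u : ℂ → ℂ} (hu : MeromorphicAt u z₀) {m : ℤ}
    (hm : meromorphicOrderAt u z₀ = m) : HasPoleLE (m.toNat + k) (fun z => (u z)⁻¹ • F z) z₀ := by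
  have h_order := (hasPoleLE_iff_meromorphicOrderAt hF.meromorphicAt).1 hF
  have h_smul : meromorphicOrderAt (u⁻¹ • F) z₀ = -(m : WithTop ℤ) + meromorphicOrderAt F z₀ := by
    rw [meromorphicOrderAt_smul hu.inv hF.meromorphicAt, meromorphicOrderAt_inv, hm]
  refine (hasPoleLE_iff_meromorphicOrderAt (hu.inv.smul hF.meromorphicAt)).2 ?_
  rw [h_smul]
  cases h_ord : meromorphicOrderAt F z₀ with
  | top => simp only [add_top, le_top]
  | coe d =>
    rw [h_ord] at h_order
    norm_cast at h_order ⊢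
    push_cast
    have := m.self_le_toNat
    omega

/-- The normal form of a meromorphic function is analytic where the order is nonnegative. -/
theorem exists_analyticAt_of_hasPoleLE_zero {S : Set ℂ} (h : ∀ w ∈ S, HasPoleLE 0 F w) :
    ∃ H : ℂ → E, ∀ w ∈ S, AnalyticAt ℂ H w ∧ ∀ᶠ z in 𝓝[≠] w, F z = H z := by
  have hF : MeromorphicOn F S := fun w hw => (h w hw).meromorphicAt
  refine ⟨toMeromorphicNFOn F S, fun w hw => ?_⟩
  have h_eq := hF.toMeromorphicNFOn_eq_self_on_nhdsNE hw
  refine ⟨((meromorphicNFOn_toMeromorphicNFOn F S hw).meromorphicOrderAt_nonneg_iff_analyticAt).1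
    ?_, h_eq.symm⟩
  rw [meromorphicOrderAt_congr h_eq]
  simpa only [Nat.cast_zero, zero_add] using
    (hasPoleLE_iff_meromorphicOrderAt (hF w hw)).1 (h w hw)

theorem hasSum_zpow_smul_iff {b : ℤ → E} (hb : ∀ n < -(k : ℤ), b n = 0) {w : ℂ} (hw : w ≠ 0)
    {S : E} : HasSum (fun n : ℤ => w ^ n • b n) S ↔
      HasSum (fun j : ℕ => w ^ j • b (j - k)) (w ^ k • S) := by
  have h_inj : Function.Injective fun j : ℕ => (j : ℤ) - k := fun i j h => by
    simpa only [sub_left_inj, Nat.cast_inj] using h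
  have h_range : ∀ n ∉ Set.range fun j : ℕ => (j : ℤ) - k, w ^ n • b n = 0 := fun n hn => by
    rw [hb n (not_le.1 fun h => hn ⟨(n + k).toNat, by simp only; omega⟩), smul_zero]
  have h_shift : ∀ j : ℕ, w ^ j • b (j - k) = w ^ k • w ^ ((j : ℤ) - k) • b (j - k) := fun j => by
    rw [smul_smul, ← zpow_natCast w k, ← zpow_add₀ hw, add_sub_cancel, zpow_natCast]
  simp only [h_shift]
  rw [← h_inj.hasSum_iff h_range]
  refine ⟨fun h => h.const_smul (w ^ k), fun h => ?_⟩
  simpa only [Function.comp_def, inv_smul_smul₀ (pow_ne_zero k hw)]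
    using h.const_smul (w ^ k)⁻¹

theorem analyticAt_iff_hasSum : AnalyticAt ℂ F z₀ ↔
    ∃ v : ℕ → E, ∀ᶠ z in 𝓝 z₀, HasSum (fun j => (z - z₀) ^ j • v j) (F z) := by
  refine ⟨fun ⟨p, hp⟩ => ⟨p.coeff, hasFPowerSeriesAt_iff'.1 hp⟩, fun ⟨v, hv⟩ =>
    ⟨fun j => ContinuousMultilinearMap.mkPiRing ℂ (Fin j) (v j), hasFPowerSeriesAt_iff'.2 ?_⟩⟩
  simpa only [FormalMultilinearSeries.coeff, ContinuousMultilinearMap.mkPiRing_apply, Pi.one_apply,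
    Finset.prod_const_one, one_smul] using hv

theorem HasPoleLE.exists_laurent (h : HasPoleLE k F z₀) :
    ∃ b : ℤ → E, (∀ n < -(k : ℤ), b n = 0) ∧
      ∀ᶠ z in 𝓝[≠] z₀, HasSum (fun n : ℤ => (z - z₀) ^ n • b n) (F z) := by
  obtain ⟨P, hP, hFP⟩ := h
  obtain ⟨v, hv⟩ := analyticAt_iff_hasSum.1 hP
  obtain ⟨b, hb, hbv⟩ := exists_shifted_coeff k v
  refine ⟨b, hb, ?_⟩
  filter_upwards [hFP, hv.filter_mono nhdsWithin_le_nhds, self_mem_nhdsWithin] with z hFz hvz hz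
  rw [hasSum_zpow_smul_iff hb (sub_ne_zero.2 hz), hFz]
  simpa only [hbv] using hvz

theorem exists_analyticAt_of_summable_zpow {b : ℤ → E} (hb : ∀ n < -(k : ℤ), b n = 0)
    (h : ∀ᶠ z in 𝓝[≠] z₀, Summable fun n : ℤ => (z - z₀) ^ n • b n) :
    ∃ G : ℂ → E, AnalyticAt ℂ G z₀ ∧
      ∀ᶠ z in 𝓝[≠] z₀, HasSum (fun n : ℤ => (z - z₀) ^ n • b n) (((z - z₀) ^ k)⁻¹ • G z) := by
  have h_sum : ∀ᶠ z in 𝓝 z₀, HasSum (fun j : ℕ => (z - z₀) ^ j • b (j - k))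
      (∑' j : ℕ, (z - z₀) ^ j • b (j - k)) := by
    filter_upwards [eventually_nhdsWithin_iff.1 h] with z hz
    rcases eq_or_ne z z₀ with rfl | hne
    · exact (summable_of_ne_finset_zero (s := {0}) fun j hj => by
        rw [sub_self, zero_pow (Finset.notMem_singleton.1 hj), zero_smul]).hasSum
    · exact ((hasSum_zpow_smul_iff hb (sub_ne_zero.2 hne)).1 (hz hne).hasSum).summable.hasSum
  refine ⟨_, analyticAt_iff_hasSum.2 ⟨_, h_sum⟩, ?_⟩
  filter_upwards [h_sum.filter_mono nhdsWithin_le_nhds, self_mem_nhdsWithin] with z hz hne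
  rwa [hasSum_zpow_smul_iff hb (sub_ne_zero.2 hne),
    smul_inv_smul₀ (pow_ne_zero k (sub_ne_zero.2 hne))]

theorem hasPoleLE_of_laurent {b : ℤ → E} (hb : ∀ n < -(k : ℤ), b n = 0)
    (h : ∀ᶠ z in 𝓝[≠] z₀, HasSum (fun n : ℤ => (z - z₀) ^ n • b n) (F z)) : HasPoleLE k F z₀ := by
  obtain ⟨G, hG, hG_sum⟩ :=
    exists_analyticAt_of_summable_zpow hb (h.mono fun _ hz => hz.summable)
  refine (hasPoleLE_inv_pow_smul k hG).congr ?_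
  filter_upwards [h, hG_sum] with z hz hGz
  exact hGz.unique hz

end Poles

/-! ### Expansions in powers of a quadratic polynomial -/

section Quad

variable {E : Type*} [NormedAddCommGroup E] [NormedSpace ℂ E] {F : ℂ → E} {k : ℕ} {a β : ℂ}

/-- The monic quadratic polynomial with zeros `a ± β`. The stem function of `Δ_y` has this form. -/
def quad (a β z : ℂ) : ℂ := (z - a) ^ 2 - β ^ 2

theorem quad_eq_mul (a β z : ℂ) : quad a β z = (z - (a + β)) * (z - (a - β)) := by
  rw [quad]
  ring

theorem quad_eq_mul_of_eq_zero {w : ℂ} (hw : quad a β w = 0) (z : ℂ) :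
    quad a β z = (z - w) * (z - (2 * a - w)) := by
  rw [quad] at hw ⊢
  linear_combination hw

theorem quad_eq_zero_iff {z : ℂ} : quad a β z = 0 ↔ z = a + β ∨ z = a - β := by
  rw [quad_eq_mul, mul_eq_zero, sub_eq_zero, sub_eq_zero]

theorem analyticAt_quad (a β w : ℂ) : AnalyticAt ℂ (quad a β) w := by
  unfold quad
  fun_prop

theorem exists_radius_quad {Q : ℂ → Prop}
    (h : ∀ w, quad a β w = 0 → ∀ᶠ z in 𝓝[≠] w, Q z) :
    ∃ r > 0, ∀ z, 0 < ‖quad a β z‖ → ‖quad a β z‖ < r → Q z := by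
  have h_near : ∀ w, quad a β w = 0 → ∃ ε > 0, ∀ z, ‖z - w‖ < ε → z ≠ w → Q z := fun w hw => by
    obtain ⟨ε, hε, h_ball⟩ := Metric.eventually_nhds_iff.1 (eventually_nhdsWithin_iff.1 (h w hw))
    exact ⟨ε, hε, fun z hz hne => h_ball (by rwa [dist_eq_norm]) hne⟩
  obtain ⟨ε₁, hε₁, h₁⟩ := h_near _ (quad_eq_zero_iff.2 (Or.inl rfl))
  obtain ⟨ε₂, hε₂, h₂⟩ := h_near _ (quad_eq_zero_iff.2 (Or.inr rfl))
  refine ⟨ε₁ * ε₂, mul_pos hε₁ hε₂, fun z hz0 hz => ?_⟩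
  have h_ne := mt quad_eq_zero_iff.2 (norm_pos_iff.1 hz0)
  rw [quad_eq_mul, norm_mul] at hz
  rcases lt_or_ge ‖z - (a + β)‖ ε₁ with hlt | hge
  · exact h₁ z hlt fun h_eq => h_ne (Or.inl h_eq)
  · refine h₂ z (lt_of_not_ge fun hge' => ?_) fun h_eq => h_ne (Or.inr h_eq)
    exact hz.not_ge (mul_le_mul hge hge' hε₂.le (norm_nonneg _))

theorem meromorphicOrderAt_quad (hβ : β ≠ 0) {w : ℂ} (hw : quad a β w = 0) :
    meromorphicOrderAt (quad a β) w = 1 := by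
  have h_mero := (analyticAt_quad a β w).meromorphicAt
  refine (meromorphicOrderAt_eq_int_iff (n := 1) h_mero).2
    ⟨fun z => z - (2 * a - w), by fun_prop, fun h => hβ ?_, Eventually.of_forall fun z => ?_⟩
  · have hwa : w = a := by linear_combination h / 2
    rwa [quad, hwa, sub_self, zero_pow two_ne_zero, zero_sub, neg_eq_zero, sq_eq_zero_iff] at hw
  · rw [zpow_one, smul_eq_mul, quad_eq_mul_of_eq_zero hw]

theorem tendsto_quad (hβ : β ≠ 0) {w : ℂ} (hw : quad a β w = 0) :
    Tendsto (quad a β) (𝓝[≠] w) (𝓝[≠] 0) := by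
  have h_ne : meromorphicOrderAt (quad a β) w ≠ ⊤ := by
    rw [meromorphicOrderAt_quad hβ hw]
    exact WithTop.one_ne_top
  refine tendsto_nhdsWithin_iff.2 ⟨?_, ?_⟩
  · rw [← hw]
    exact (analyticAt_quad a β w).continuousAt.continuousWithinAt.tendsto
  · exact (meromorphicOrderAt_ne_top_iff_eventually_ne_zero
      (analyticAt_quad a β w).meromorphicAt).1 h_ne

theorem exists_analyticAt_sqrt (hβ : β ≠ 0) :
    ∃ s : ℂ → ℂ, AnalyticAt ℂ s 0 ∧ s 0 = β ∧ ∀ w, s w ^ 2 = w + β ^ 2 := by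
  refine ⟨fun w => β * (1 + w / β ^ 2) ^ ((2 : ℕ) : ℂ)⁻¹, ?_, ?_, fun w => ?_⟩
  · refine analyticAt_const.mul (AnalyticAt.cpow (by fun_prop) analyticAt_const ?_)
    rw [zero_div, add_zero]
    exact Complex.one_mem_slitPlane
  · simp only [zero_div, add_zero, Complex.one_cpow, mul_one]
  · rw [mul_pow, Complex.cpow_nat_inv_pow _ two_ne_zero]
    field_simp
    ring

theorem eq_add_smul_of_sq_eq (H : ℂ → E) {z σ : ℂ} (hσ : σ ≠ 0) (h : (z - a) ^ 2 = σ ^ 2) :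
    H z = (1 / 2 : ℂ) • (H (a + σ) + H (a - σ)) +
      (z - a) • (2 * σ)⁻¹ • (H (a + σ) - H (a - σ)) := by
  rcases sq_eq_sq_iff_eq_or_eq_neg.1 h with h | h
  · rw [h, show z = a + σ by linear_combination h]
    match_scalars <;> field_simp <;> ring
  · rw [h, show z = a - σ by linear_combination h]
    match_scalars <;> field_simp <;> ring

/-- Along a branch `s` of the square root of `q + β²` the points `a ± s q` are the solutions of
`quad a β z = q`: take the even and odd parts of `H` in `s`. -/
theorem exists_eq_add_smul_quad (hβ : β ≠ 0) {H : ℂ → E}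
    (hH : ∀ w, quad a β w = 0 → AnalyticAt ℂ H w) :
    ∃ u v : ℂ → E, AnalyticAt ℂ u 0 ∧ AnalyticAt ℂ v 0 ∧
      ∀ᶠ q in 𝓝 0, ∀ z, quad a β z = q → H z = u q + (z - a) • v q := by
  obtain ⟨s, hs, hs0, hs_sq⟩ := exists_analyticAt_sqrt hβ
  have hs_ne : s 0 ≠ 0 := by rwa [hs0]
  have h_plus : AnalyticAt ℂ (fun q => H (a + s q)) 0 :=
    (hH (a + s 0) (by rw [hs0, quad_eq_zero_iff]; exact Or.inl rfl)).fun_comp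
      (f := fun q => a + s q) (analyticAt_const.add hs)
  have h_minus : AnalyticAt ℂ (fun q => H (a - s q)) 0 :=
    (hH (a - s 0) (by rw [hs0, quad_eq_zero_iff]; exact Or.inr rfl)).fun_comp
      (f := fun q => a - s q) (analyticAt_const.sub hs)
  refine ⟨fun q => (1 / 2 : ℂ) • (H (a + s q) + H (a - s q)),
    fun q => (2 * s q)⁻¹ • (H (a + s q) - H (a - s q)), analyticAt_const.smul (h_plus.add h_minus),
    ((analyticAt_const.mul hs).inv (mul_ne_zero two_ne_zero hs_ne)).smul (h_plus.sub h_minus), ?_⟩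
  filter_upwards [hs.continuousAt.eventually_ne hs_ne] with q hq z hz
  refine eq_add_smul_of_sq_eq H hq ?_
  rw [hs_sq, ← hz, quad, sub_add_cancel]

theorem HasPoleLE.quad_pow_smul {w : ℂ} (h : HasPoleLE k F w) (hw : quad a β w = 0) :
    HasPoleLE 0 (fun z => quad a β z ^ k • F z) w := by
  obtain ⟨P, hP, hFP⟩ := h
  refine (hasPoleLE_of_analyticAt 0 (F := fun z => (z - (2 * a - w)) ^ k • P z)
    (AnalyticAt.smul (by fun_prop) hP)).congr ?_
  filter_upwards [hFP] with z hz
  rw [← hz, smul_smul, ← mul_pow, mul_comm, ← quad_eq_mul_of_eq_zero hw]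

theorem exists_quad_expansion (hβ : β ≠ 0) (hF : ∀ w, quad a β w = 0 → HasPoleLE k F w) :
    ∃ U V : ℤ → E, (∀ n < -(k : ℤ), U n = 0) ∧ (∀ n < -(k : ℤ), V n = 0) ∧
      ∃ r > 0, ∀ z, 0 < ‖quad a β z‖ → ‖quad a β z‖ < r → ∃ u v : E,
        HasSum (fun n : ℤ => quad a β z ^ n • U n) u ∧
        HasSum (fun n : ℤ => quad a β z ^ n • V n) v ∧ F z = u + (z - a) • v := by
  obtain ⟨H, hH⟩ := exists_analyticAt_of_hasPoleLE_zero (S := {w | quad a β w = 0})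
    fun w hw => (hF w hw).quad_pow_smul hw
  obtain ⟨u, v, hu, hv, h_eq⟩ := exists_eq_add_smul_quad hβ fun w hw => (hH w hw).1
  obtain ⟨U, hU, hU_sum⟩ := (hasPoleLE_inv_pow_smul k hu).exists_laurent
  obtain ⟨V, hV, hV_sum⟩ := (hasPoleLE_inv_pow_smul k hv).exists_laurent
  refine ⟨U, V, hU, hV, exists_radius_quad fun w hw => ?_⟩
  have h_tend := tendsto_quad hβ hw
  filter_upwards [(hH w hw).2, h_tend.eventually hU_sum, h_tend.eventually hV_sum,
    h_tend.eventually (h_eq.filter_mono nhdsWithin_le_nhds),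
    h_tend.eventually self_mem_nhdsWithin] with z hFz hUz hVz h_eqz hz
  simp only [sub_zero] at hUz hVz
  refine ⟨_, _, hUz, hVz, ?_⟩
  rw [smul_comm, ← smul_add, ← h_eqz z rfl, ← hFz, inv_smul_smul₀ (pow_ne_zero k hz)]

theorem summable_of_quad_expansion {U V : ℤ → E} {r : ℝ}
    (h : ∀ z, 0 < ‖quad a β z‖ → ‖quad a β z‖ < r →
      HasSum (fun n : ℤ => quad a β z ^ n • (U n + (z - a) • V n)) (F z)) {q : ℂ}
    (hq0 : 0 < ‖q‖) (hqr : ‖q‖ < r) (hq : q + β ^ 2 ≠ 0) :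
    Summable (fun n : ℤ => q ^ n • U n) ∧ Summable (fun n : ℤ => q ^ n • V n) := by
  obtain ⟨σ, hσ⟩ : ∃ σ : ℂ, σ ^ 2 = q + β ^ 2 := ⟨_, Complex.cpow_nat_inv_pow _ two_ne_zero⟩
  have hσ_ne : σ ≠ 0 := fun h0 => hq (by rw [← hσ, h0, zero_pow two_ne_zero])
  have h_plus : quad a β (a + σ) = q := by rw [quad]; linear_combination hσ
  have h_minus : quad a β (a - σ) = q := by rw [quad]; linear_combination hσ
  have hs := (h (a + σ) (by rwa [h_plus]) (by rwa [h_plus])).summable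
  have hs' := (h (a - σ) (by rwa [h_minus]) (by rwa [h_minus])).summable
  simp only [h_plus] at hs
  simp only [h_minus] at hs'
  refine ⟨((hs.add hs').const_smul (1 / 2 : ℂ)).congr fun n => ?_,
    ((hs.sub hs').const_smul (2 * σ)⁻¹).congr fun n => ?_⟩
  · match_scalars <;> ring
  · match_scalars <;> field_simp <;> ring

theorem eventually_nhdsNE_norm_lt {r : ℝ} (hr : 0 < r) :
    ∀ᶠ q in 𝓝[≠] (0 : ℂ), 0 < ‖q‖ ∧ ‖q‖ < r := by
  filter_upwards [self_mem_nhdsWithin, nhdsWithin_le_nhds (Metric.ball_mem_nhds 0 hr)]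
    with q hq hqr
  exact ⟨norm_pos_iff.2 hq, mem_ball_zero_iff.1 hqr⟩

theorem eventually_summable_of_quad_expansion (hβ : β ≠ 0) {U V : ℤ → E} {r : ℝ} (hr : 0 < r)
    (h : ∀ z, 0 < ‖quad a β z‖ → ‖quad a β z‖ < r →
      HasSum (fun n : ℤ => quad a β z ^ n • (U n + (z - a) • V n)) (F z)) :
    ∀ᶠ q in 𝓝[≠] (0 : ℂ),
      Summable (fun n : ℤ => q ^ n • U n) ∧ Summable (fun n : ℤ => q ^ n • V n) := by
  have h_ne : ∀ᶠ q in 𝓝[≠] (0 : ℂ), q + β ^ 2 ≠ 0 :=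
    ((continuousAt_id.add continuousAt_const).eventually_ne
      (by simpa using hβ)).filter_mono nhdsWithin_le_nhds
  filter_upwards [eventually_nhdsNE_norm_lt hr, h_ne] with q hq hqβ
  exact summable_of_quad_expansion h hq.1 hq.2 hqβ

theorem hasPoleLE_of_quad_expansion (hβ : β ≠ 0) {U V : ℤ → E} (hU : ∀ n < -(k : ℤ), U n = 0)
    (hV : ∀ n < -(k : ℤ), V n = 0) {r : ℝ} (hr : 0 < r)
    (h : ∀ z, 0 < ‖quad a β z‖ → ‖quad a β z‖ < r →
      HasSum (fun n : ℤ => quad a β z ^ n • (U n + (z - a) • V n)) (F z)) {w : ℂ}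
    (hw : quad a β w = 0) : HasPoleLE k F w := by
  have h_summable := eventually_summable_of_quad_expansion hβ hr h
  obtain ⟨u, hu, hu_sum⟩ := exists_analyticAt_of_summable_zpow hU (z₀ := 0) <| by
    simpa only [sub_zero] using h_summable.mono fun q hq => hq.1
  obtain ⟨v, hv, hv_sum⟩ := exists_analyticAt_of_summable_zpow hV (z₀ := 0) <| by
    simpa only [sub_zero] using h_summable.mono fun q hq => hq.2
  have h_quad := analyticAt_quad a β w
  have h_num : AnalyticAt ℂ (fun z => u (quad a β z) + (z - a) • v (quad a β z)) w := by
    rw [← hw] at hu hv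
    exact (hu.fun_comp h_quad).add ((analyticAt_id.sub analyticAt_const).smul (hv.fun_comp h_quad))
  have h_pow : meromorphicOrderAt (quad a β ^ k) w = (k : ℤ) := by
    rw [meromorphicOrderAt_pow h_quad.meromorphicAt, meromorphicOrderAt_quad hβ hw, mul_one]
    rfl
  refine ((hasPoleLE_of_analyticAt 0 h_num).inv_smul (h_quad.meromorphicAt.pow k) h_pow).congr ?_
  have h_tend := tendsto_quad hβ hw
  filter_upwards [h_tend.eventually (eventually_nhdsNE_norm_lt hr), h_tend.eventually hu_sum,
    h_tend.eventually hv_sum] with z hz huz hvz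
  simp only [sub_zero] at huz hvz
  refine HasSum.unique ?_ (h z hz.1 hz.2)
  convert huz.add (hvz.const_smul (z - a)) using 2 with n
  · rw [smul_add, smul_comm (z - a)]
  · rw [smul_add, smul_comm (z - a), Pi.pow_apply]

end Quad

/-! ### The terms of Laurent and spherical Laurent series -/

section Terms

variable {A : Type*} [NormedStarAlg A]

theorem deltaStem_conj (y : A) (z : ℂ) : deltaStem y (conj z) = conj (deltaStem y z) := by
  simp only [deltaStem, map_add, map_sub, map_pow, map_mul, Complex.conj_ofReal]

theorem isStem_binomStem (y : A) (D : Set ℂ) : IsStem D (binomStem y) := fun z _ => by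
  simp only [binomStem, cconj, Complex.conj_re, Complex.conj_im, neg_smul]

theorem isStem_cpow {D : Set ℂ} {F : ℂ → A × A} (hF : IsStem D F) (n : ℕ) :
    IsStem D (fun z => cpow (F z) n) := by
  induction n with
  | zero => exact isStem_const_real D 1
  | succ n ih => exact isStem_cmul hF ih

theorem isStem_binomZPowStem (y : A) (n : ℤ) (D : Set ℂ) : IsStem D (binomZPowStem y n) := by
  match n with
  | Int.ofNat k => exact isStem_cpow (isStem_binomStem y D) k
  | Int.negSucc k =>
    exact isStem_cpow (F := binomInvStem y) (isStem_csmul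
      (fun z _ => by rw [deltaStem_conj, map_inv₀]) (isStem_binomStem (star y) D)) (k + 1)

theorem isStem_sphericalStem (y : A) (n : ℤ) (c : A) (D : Set ℂ) :
    IsStem D (fun z => csmul (deltaStem y z ^ (n / 2))
      (if Even n then (c, 0) else cmul (binomStem y z) (c, 0))) := by
  refine isStem_csmul (fun z _ => by rw [deltaStem_conj, map_zpow₀]) ?_
  split_ifs
  · exact isStem_const_real D c
  · exact isStem_cmul (isStem_binomStem y D) (isStem_const_real D c)

theorem csmul_pt_pt (J : A) (u v w : ℂ) : csmul w (pt J u, pt J v) =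
    (pt J (w.re * u - w.im * v), pt J (w.re * v + w.im * u)) := by
  ext <;> simp only [csmul, pt, Complex.sub_re, Complex.sub_im, Complex.add_re, Complex.add_im,
    Complex.re_ofReal_mul, Complex.im_ofReal_mul] <;> module

theorem binomStem_pt (J : A) (z₀ z : ℂ) :
    binomStem (pt J z₀) z = (pt J (z.re - z₀), pt J z.im) := by
  rw [binomStem, pt_sub, pt_ofReal, pt_ofReal]

variable [IsSliceAlg A] {J : A}

theorem ind_pt {F : ℂ → A × A} (hF : IsStem Set.univ F) (hJ : J ∈ imagUnits A) (z : ℂ) :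
    ind F (pt J z) = ev J (F z) :=
  induces_ind (Ω := circ Set.univ) (hF.mono (Set.subset_univ _)) z
    (mem_sliceDom_circ.2 (Or.inl trivial)) J hJ

theorem deltaStem_pt (hJ : J ∈ imagUnits A) (z₀ z : ℂ) :
    deltaStem (pt J z₀) z = (z - z₀) * (z - conj z₀) := by
  rw [deltaStem, reR_pt hJ, norm_pt hJ, ← Complex.normSq_eq_norm_sq, ← Complex.mul_conj,
    ← Complex.add_conj]
  ring

theorem deltaStem_eq_quad {y : A} (hy : y ∈ quadCone A) :
    deltaStem y = quad (coord y).re ((coord y).im * Complex.I) := by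
  obtain ⟨J, hJ, e⟩ := exists_eq_pt_coord hy
  ext z
  have h_conj : ((coord y).re : ℂ) - (coord y).im * Complex.I = conj (coord y) := by
    apply Complex.ext <;> simp
  rw [quad_eq_mul, Complex.re_add_im, h_conj]
  conv_lhs => rw [e, deltaStem_pt hJ]

theorem deltaStem_eq_zero_iff {y : A} (hy : y ∈ quadCone A) {w : ℂ} :
    deltaStem y w = 0 ↔ w = coord y ∨ w = conj (coord y) := by
  obtain ⟨J, hJ, e⟩ := exists_eq_pt_coord hy
  conv_lhs => rw [e, deltaStem_pt hJ, mul_eq_zero, sub_eq_zero, sub_eq_zero]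

theorem exists_cpow_pt (hJ : J ∈ imagUnits A) (u v : ℂ) (k : ℕ) :
    ∃ u' v' : ℂ, cpow (pt J u, pt J v) k = (pt J u', pt J v') ∧
      u' + Complex.I * v' = (u + Complex.I * v) ^ k := by
  induction k with
  | zero => exact ⟨1, 0, by simp [cpow, pt], by simp⟩
  | succ k ih =>
    obtain ⟨u', v', h_pow, h_eq⟩ := ih
    refine ⟨u * u' - v * v', u * v' + v * u', ?_, ?_⟩
    · rw [cpow, h_pow, cmul, pt_mul hJ, pt_mul hJ, pt_mul hJ, pt_mul hJ, pt_sub, Prod.mk.injEq]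
      refine ⟨rfl, ?_⟩
      simp only [pt, Complex.add_re, Complex.add_im]
      module
    · rw [pow_succ, ← h_eq]
      linear_combination -(v * v') * Complex.I_sq

theorem ev_cpow_cmul (hJ : J ∈ imagUnits A) (u v : ℂ) (k : ℕ) (q : A × A) :
    ev J (cmul (cpow (pt J u, pt J v) k) q) = pt J ((u + Complex.I * v) ^ k) * ev J q := by
  obtain ⟨u', v', h_pow, h_eq⟩ := exists_cpow_pt hJ u v k
  rw [h_pow, ev_cmul_pt hJ, h_eq]

/-- On the plane `ℂ_J` through `y` the slice powers of `x - y` are the ordinary ones. -/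
theorem laurentTerm_pt (hJ : J ∈ imagUnits A) {z₀ z : ℂ} (hz : z ≠ conj z₀) (n : ℤ) (a : A) :
    laurentTerm (pt J z₀) n a (pt J z) = pt J ((z - z₀) ^ n) * a := by
  have h_ev : ev J (a, (0 : A)) = a := by rw [ev, mul_zero, add_zero]
  have hz_eq : (z.re : ℂ) + Complex.I * z.im = z := by rw [mul_comm, Complex.re_add_im]
  rw [laurentTerm, ind_pt (isStem_cmul (isStem_binomZPowStem _ n _) (isStem_const_real _ a)) hJ]
  match n with
  | Int.ofNat k =>
    change ev J (cmul (cpow (binomStem (pt J z₀) z) k) (a, 0)) = _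
    rw [binomStem_pt, ev_cpow_cmul hJ, h_ev, Int.ofNat_eq_natCast, zpow_natCast,
      show (z.re : ℂ) - z₀ + Complex.I * z.im = z - z₀ by linear_combination hz_eq]
  | Int.negSucc k =>
    set w := (deltaStem (pt J z₀) z)⁻¹ with hw
    have hw_eq : (w.re : ℂ) + Complex.I * w.im = w := by rw [mul_comm, Complex.re_add_im]
    have h_split : (w.re : ℂ) * ((z.re : ℂ) - conj z₀) - w.im * z.im +
        Complex.I * (w.re * z.im + w.im * ((z.re : ℂ) - conj z₀)) = w * (z - conj z₀) := by
      linear_combination (z - conj z₀) * hw_eq +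
        ((w.re : ℂ) + Complex.I * w.im) * hz_eq - w.im * z.im * Complex.I_sq
    change ev J (cmul (cpow (binomInvStem (pt J z₀) z) (k + 1)) (a, 0)) = _
    rw [binomInvStem, ← hw, star_pt hJ, binomStem_pt, csmul_pt_pt, ev_cpow_cmul hJ, h_ev, h_split,
      zpow_negSucc, ← inv_pow, hw, deltaStem_pt hJ, mul_inv, mul_assoc,
      inv_mul_cancel₀ (sub_ne_zero.2 hz), mul_one]

end Terms

section Shells

variable {A : Type*} [NormedStarAlg A] [IsSliceAlg A] {J y : A}

theorem delta_pt (hJ : J ∈ imagUnits A) (hy : y ∈ quadCone A) (z : ℂ) :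
    pt J z * pt J z - pt J z * (y + star y) + y * star y = pt J (deltaStem y z) := by
  obtain ⟨J', hJ', z₀, rfl⟩ := mem_quadCone_iff.1 hy
  rw [pt_add_star hJ', pt_mul_star hJ', pt_mul hJ, mul_smul_A, mul_one, deltaStem,
    reR_pt hJ', norm_pt hJ', ← pow_two, mul_comm z]
  simp only [pt, Complex.add_re, Complex.add_im, Complex.sub_re, Complex.sub_im,
    Complex.re_ofReal_mul, Complex.im_ofReal_mul, Complex.ofReal_re, Complex.ofReal_im]
  module

theorem cassini_pt (hJ : J ∈ imagUnits A) (hy : y ∈ quadCone A) (z : ℂ) :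
    cassini (pt J z) y = Real.sqrt ‖deltaStem y z‖ := by
  rw [cassini, delta_pt hJ hy, norm_pt hJ]

theorem pt_mem_cassiniShell_iff (hJ : J ∈ imagUnits A) (hy : y ∈ quadCone A) {z : ℂ} {r : ℝ}
    (hr : 0 < r) :
    pt J z ∈ cassiniShell y 0 r ↔ 0 < ‖deltaStem y z‖ ∧ ‖deltaStem y z‖ < r ^ 2 := by
  rw [cassiniShell, Set.mem_sep_iff, cassini_pt hJ hy, Real.sqrt_pos, Real.sqrt_lt' hr]
  exact and_iff_right (pt_mem_quadCone hJ z)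

theorem pt_mem_cassiniBall_iff (hJ : J ∈ imagUnits A) (hy : y ∈ quadCone A) {z : ℂ} {r : ℝ}
    (hr : 0 < r) : pt J z ∈ cassiniBall y r ↔ ‖deltaStem y z‖ < r ^ 2 := by
  rw [cassiniBall, Set.mem_sep_iff, cassini_pt hJ hy, Real.sqrt_lt' hr]
  exact and_iff_right (pt_mem_quadCone hJ z)

theorem pt_mem_sigmaShell (hJ : J ∈ imagUnits A) {z₀ z : ℂ} {R : ℝ} (h0 : 0 < ‖z - z₀‖)
    (hR : ‖z - z₀‖ < R) : pt J z ∈ sigmaShell (pt J z₀) 0 R := by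
  have h_same : SameSlice (pt J z) (pt J z₀) := ⟨J, hJ, ⟨z, rfl⟩, ⟨z₀, rfl⟩⟩
  refine ⟨pt_mem_quadCone hJ z, ?_⟩
  rw [tauDist, sigmaDist, if_pos h_same, if_pos h_same, ← pt_sub, norm_pt hJ]
  exact ⟨h0, hR⟩

theorem SameSlice.exists_eq_pt_coord {x : A} (h : SameSlice x y) :
    ∃ J ∈ imagUnits A, y = pt J (coord y) ∧ ∃ z, x = pt J z := by
  obtain ⟨J, hJ, ⟨z, rfl⟩, ⟨w, rfl⟩⟩ := h
  rcases coord_pt_eq_or hJ w with hw | hw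
  · exact ⟨J, hJ, by rw [hw], z, rfl⟩
  · exact ⟨-J, neg_mem_imagUnits hJ, by rw [hw, pt_neg, Complex.conj_conj], conj z,
      by rw [pt_neg, Complex.conj_conj]⟩

theorem sameSlice_of_sigmaDist_lt {x : A} (hx : x ∈ quadCone A) (hy : y ∈ quadCone A)
    (h : (coord y).im = 0 ∨ sigmaDist x y < (coord y).im) : SameSlice x y := by
  rcases h with h_im | h_lt
  · obtain ⟨J, hJ, e⟩ := exists_eq_pt_coord hx
    obtain ⟨J', -, e'⟩ := exists_eq_pt_coord hy
    refine ⟨J, hJ, ⟨_, e.symm⟩, ⟨coord y, ?_⟩⟩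
    rw [pt_of_im_eq_zero J h_im, ← pt_of_im_eq_zero J' h_im, ← e']
  · by_contra h_same
    rw [sigmaDist, if_neg h_same] at h_lt
    refine h_lt.not_ge (Real.le_sqrt_of_sq_le ?_)
    change ‖imA y‖ ^ 2 ≤ _
    nlinarith [sq_nonneg ‖reA x - reA y‖, norm_nonneg (imA x), norm_nonneg (imA y)]

/-- For small radii, `Σ(y, 0, R)` is a punctured disc, or a punctured ball if `y` is real. -/
theorem exists_of_mem_sigmaShell {x : A} (hy : y ∈ quadCone A) {R : ℝ}
    (hR : (coord y).im = 0 ∨ R ≤ (coord y).im) (hx : x ∈ sigmaShell y 0 R) :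
    ∃ J ∈ imagUnits A, y = pt J (coord y) ∧
      ∃ z, x = pt J z ∧ 0 < ‖z - coord y‖ ∧ ‖z - coord y‖ < R := by
  obtain ⟨hxq, h0, hlt⟩ := hx
  have h_same : SameSlice x y := sameSlice_of_sigmaDist_lt hxq hy (hR.imp_right hlt.trans_le)
  obtain ⟨J, hJ, e, z, rfl⟩ := h_same.exists_eq_pt_coord
  have h_norm : ‖pt J z - y‖ = ‖z - coord y‖ := by
    conv_lhs => rw [e, ← pt_sub, norm_pt hJ]
  rw [tauDist, if_pos h_same, h_norm] at h0
  rw [sigmaDist, if_pos h_same, h_norm] at hlt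
  exact ⟨J, hJ, e, z, rfl, h0, hlt⟩

end Shells

/-! ### Laurent expansions -/

section Laurent

variable {A : Type*} [NormedStarAlg A] {Ω : Set A} {f : A → A} {J y : A} {z₀ : ℂ} {k : ℕ}

theorem sInf_mem_of_ne_top {S : Set ℕ∞} (h : sInf S ≠ ⊤) : sInf S ∈ S :=
  csInf_mem <| Set.nonempty_iff_ne_empty.2 fun h_empty => h (h_empty ▸ sInf_empty)

theorem exists_isLaurentExpansion_of_ord_ne_top (h : ord Ω f y ≠ ⊤) :
    ∃ k : ℕ, ord Ω f y = k ∧ ∃ a : ℤ → A, IsLaurentExpansion Ω f y a ∧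
      ∀ n < -(k : ℤ), a n = 0 :=
  sInf_mem_of_ne_top h

variable [IsSliceAlg A]

attribute [local instance] IsSliceAlg.finiteDimensional

theorem eventually_nhdsNE_iff_exists_radius {p : ℂ → Prop} :
    (∀ᶠ z in 𝓝[≠] z₀, p z) ↔ ∃ R > 0, ∀ z, 0 < ‖z - z₀‖ → ‖z - z₀‖ < R → p z := by
  simp only [eventually_nhdsWithin_iff, Metric.eventually_nhds_iff, dist_eq_norm, norm_pos_iff,
    sub_ne_zero, Set.mem_compl_singleton_iff]
  exact exists_congr fun R => and_congr_right fun _ => forall_congr' fun z => imp.swap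

theorem eventually_nhdsNE_pt_mem_sigmaShell (hJ : J ∈ imagUnits A) {R : ℝ} (hR : 0 < R) :
    ∀ᶠ z in 𝓝[≠] z₀, pt J z ∈ sigmaShell (pt J z₀) 0 R :=
  eventually_nhdsNE_iff_exists_radius.2 ⟨R, hR, fun _ => pt_mem_sigmaShell hJ⟩

theorem eventually_nhdsNE_ne_conj (z₀ : ℂ) : ∀ᶠ z in 𝓝[≠] z₀, z ≠ conj z₀ := by
  by_cases h : z₀ = conj z₀
  · rw [← h]
    exact self_mem_nhdsWithin
  · exact (continuousAt_id.eventually_ne h).filter_mono nhdsWithin_le_nhds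

theorem IsSingularity.eventually_mem_sliceDom (hJ : J ∈ imagUnits A)
    (h : IsSingularity Ω (pt J z₀)) : ∀ᶠ z in 𝓝[≠] z₀, z ∈ sliceDom Ω := by
  obtain ⟨-, R, hR, h_sub⟩ := h
  filter_upwards [eventually_nhdsNE_pt_mem_sigmaShell hJ hR] with z hz using ⟨J, hJ, h_sub hz⟩

theorem IsLaurentExpansion.hasPoleLE (hJ : J ∈ imagUnits A) {a : ℤ → A}
    (h : IsLaurentExpansion Ω f (pt J z₀) a) (ha : ∀ n < -(k : ℤ), a n = 0) :
    HasPoleLE k (fun z => epsCoord J (f (pt J z))) z₀ := by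
  obtain ⟨R, hR, -, h_sum⟩ := h
  refine hasPoleLE_of_laurent (b := fun n => epsCoord J (a n))
    (fun n hn => by rw [ha n hn, map_zero]) ?_
  filter_upwards [eventually_nhdsNE_ne_conj z₀, eventually_nhdsNE_pt_mem_sigmaShell hJ hR]
    with z hz hz_mem
  refine ((h_sum _ hz_mem).mapL (epsCoord J)).congr_fun fun n => ?_
  rw [laurentTerm_pt hJ hz, epsCoord_pt_mul hJ]

theorem IsPole.exists_hasPoleLE (hJ : J ∈ imagUnits A) (h : IsPole Ω f (pt J z₀)) :
    ∃ k, HasPoleLE k (fun z => epsCoord J (f (pt J z))) z₀ := by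
  obtain ⟨k, -, a, h_exp, ha⟩ := exists_isLaurentExpansion_of_ord_ne_top h.2.ne
  exact ⟨k, h_exp.hasPoleLE hJ ha⟩

theorem IsRemovable.hasPoleLE (hc : IsCircular Ω) (hJ : J ∈ imagUnits A)
    (h : IsRemovable Ω f (pt J z₀)) : HasPoleLE 0 (stemCoord f) z₀ := by
  have h_mem := h.1.eventually_mem_sliceDom hJ
  obtain ⟨-, Ω₁, g, -, hy, hg, hgf⟩ := h
  refine (hasPoleLE_of_analyticAt 0 (hg.analyticAt_stemCoord ⟨J, hJ, hy⟩)).congr ?_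
  filter_upwards [h_mem] with z hz
  have h_conj := hc.conj_mem hz
  rw [stemCoord, stemCoord, stem, stem, hgf _ ((hc.pt_mem_iff someUnit_mem).2 hz),
    hgf _ ((hc.pt_mem_iff someUnit_mem).2 h_conj)]

theorem IsSlice.hasPoleLE_stemCoord (h : IsSlice Ω f) (hJ : J ∈ imagUnits A)
    (h_mem : ∀ᶠ z in 𝓝[≠] z₀, z ∈ sliceDom Ω)
    (h_pos : HasPoleLE k (fun z => epsCoord J (f (pt J z))) z₀)
    (h_neg : HasPoleLE k (fun z => epsCoord (-J) (f (pt (-J) z))) z₀) :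
    HasPoleLE k (stemCoord f) z₀ :=
  (h_pos.add h_neg).congr <| h_mem.mono fun _ hz => (h.stemCoord_eq_add hJ hz).symm

theorem hasSum_smul_realPart {ι : Type*} {u : ι → ℂ} {v : ι → CoordSpace A} {S S' : CoordSpace A}
    (h : HasSum (fun i => u i • v i) S) (h' : HasSum (fun i => conj (u i) • v i) S') :
    HasSum (fun i => u i • toCoord ((toCoord.symm (v i)).1, (0 : A)))
      ((1 / 2 : ℂ) • (S + star S')) := by
  refine ((h.add h'.star).const_smul (1 / 2 : ℂ)).congr_fun fun i => ?_
  rw [toCoord_symm_fst, smul_comm, star_smul, RCLike.star_def, Complex.conj_conj, smul_add]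

theorem evCoord_toCoord_fst (J a : A) : evCoord J (toCoord (a, 0)) = a := by
  rw [evCoord_toCoord, ev, mul_zero, add_zero]

theorem eventually_nhdsNE_conj {p : ℂ → Prop} (h₀ : conj z₀ = z₀) (h : ∀ᶠ z in 𝓝[≠] z₀, p z) :
    ∀ᶠ z in 𝓝[≠] z₀, p (conj z) := by
  obtain ⟨R, hR, hp⟩ := eventually_nhdsNE_iff_exists_radius.1 h
  have h_norm (z : ℂ) : ‖conj z - z₀‖ = ‖z - z₀‖ := by
    rw [← RCLike.norm_conj (z - z₀), map_sub, h₀]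
  exact eventually_nhdsNE_iff_exists_radius.2
    ⟨R, hR, fun z h0 hz => hp _ (by rwa [h_norm]) (by rwa [h_norm])⟩

/-- At a real point the Laurent coefficients of a stem function lie in `A`, as is seen by averaging
the expansions at `z` and `conj z`. -/
theorem IsSlice.exists_real_laurent (h : IsSlice Ω f) (h₀ : conj z₀ = z₀)
    (h_mem : ∀ᶠ z in 𝓝[≠] z₀, z ∈ sliceDom Ω) (h_pole : HasPoleLE k (stemCoord f) z₀) :
    ∃ a : ℤ → A, (∀ n < -(k : ℤ), a n = 0) ∧
      ∀ᶠ z in 𝓝[≠] z₀, HasSum (fun n : ℤ => (z - z₀) ^ n • toCoord (a n, 0)) (stemCoord f z) := by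
  obtain ⟨b, hb, h_sum⟩ := h_pole.exists_laurent
  refine ⟨fun n => (toCoord.symm (b n)).1,
    fun n hn => by simp only [hb n hn, map_zero, Prod.fst_zero], ?_⟩
  filter_upwards [h_mem, h_sum, eventually_nhdsNE_conj h₀ h_sum] with z hz h_sum_z h_sum_conj
  have h_avg := hasSum_smul_realPart h_sum_z (S' := stemCoord f (conj z)) <| by
    simpa only [map_zpow₀, map_sub, h₀] using h_sum_conj
  rwa [h.stemCoord_conj hz, star_star, ← two_smul ℂ, smul_smul, one_div,
    inv_mul_cancel₀ two_ne_zero, one_smul] at h_avg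

/-- The coefficients do not depend on the plane: a real point lies in all of them, but its
coefficients are in `A`, while any other point lies in one plane only. -/
theorem IsSlice.exists_laurent (h : IsSlice Ω f) (hy : y ∈ quadCone A)
    (h_mem : ∀ᶠ z in 𝓝[≠] coord y, z ∈ sliceDom Ω)
    (h_pole : HasPoleLE k (stemCoord f) (coord y)) :
    ∃ a : ℤ → A, (∀ n < -(k : ℤ), a n = 0) ∧ ∀ᶠ z in 𝓝[≠] coord y,
      ∀ J ∈ imagUnits A, y = pt J (coord y) →
        HasSum (fun n : ℤ => pt J ((z - coord y) ^ n) * a n) (f (pt J z)) := by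
  by_cases h_im : (coord y).im = 0
  · obtain ⟨a, ha, h_sum⟩ := h.exists_real_laurent (Complex.conj_eq_iff_im.2 h_im) h_mem h_pole
    refine ⟨a, ha, ?_⟩
    filter_upwards [h_mem, h_sum] with z hz h_sum_z J hJ _
    rw [← h.evCoord_stemCoord hJ hz]
    refine (h_sum_z.mapL (evCoord J)).congr_fun fun n => ?_
    rw [evCoord_smul hJ, evCoord_toCoord_fst]
  · obtain ⟨b, hb, h_sum⟩ := h_pole.exists_laurent
    obtain ⟨J₀, -, hJ₀⟩ := exists_eq_pt_coord hy
    refine ⟨fun n => evCoord J₀ (b n), fun n hn => by simp only [hb n hn, map_zero], ?_⟩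
    filter_upwards [h_mem, h_sum] with z hz h_sum_z J hJ e
    obtain rfl : J = J₀ := smul_right_injective A h_im (add_left_cancel (e.symm.trans hJ₀))
    rw [← h.evCoord_stemCoord hJ hz]
    exact (h_sum_z.mapL (evCoord J)).congr_fun fun n => (evCoord_smul hJ _ _).symm

theorem IsSlice.exists_isLaurentExpansion (h : IsSlice Ω f) (hy : y ∈ quadCone A)
    (h_mem : ∀ᶠ z in 𝓝[≠] coord y, z ∈ sliceDom Ω)
    (h_pole : HasPoleLE k (stemCoord f) (coord y)) :
    ∃ a : ℤ → A, IsLaurentExpansion Ω f y a ∧ ∀ n < -(k : ℤ), a n = 0 := by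
  obtain ⟨a, ha, h_sum⟩ := h.exists_laurent hy h_mem h_pole
  obtain ⟨R, hR, h_near⟩ := eventually_nhdsNE_iff_exists_radius.1
    ((h_mem.and h_sum).and (eventually_nhdsNE_ne_conj (coord y)))
  obtain ⟨R', hR', hle, h_small⟩ : ∃ R' > 0, R' ≤ R ∧ ((coord y).im = 0 ∨ R' ≤ (coord y).im) := by
    rcases (norm_nonneg (imA y)).eq_or_lt with h_im | h_im
    · exact ⟨R, hR, le_rfl, Or.inl h_im.symm⟩
    · exact ⟨min R (coord y).im, lt_min hR h_im, min_le_left _ _, Or.inr (min_le_right _ _)⟩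
  refine ⟨a, ⟨R', hR', fun x hx => ?_, fun x hx => ?_⟩, ha⟩ <;>
    obtain ⟨J, hJ, e, z, rfl, h0, hz⟩ := exists_of_mem_sigmaShell hy h_small hx <;>
    obtain ⟨⟨hz_mem, h_sum_z⟩, hz_ne⟩ := h_near z h0 (hz.trans_le hle)
  · exact (h.isCircular.pt_mem_iff hJ).2 hz_mem
  · refine (h_sum_z J hJ e).congr_fun fun n => ?_
    conv_lhs => rw [e, laurentTerm_pt hJ hz_ne]

theorem IsSlice.isSingularity_and_ord_le (h : IsSlice Ω f) (hy : y ∈ quadCone A)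
    (h_mem : ∀ᶠ z in 𝓝[≠] coord y, z ∈ sliceDom Ω)
    (h_pole : HasPoleLE k (stemCoord f) (coord y)) : IsSingularity Ω y ∧ ord Ω f y ≤ k := by
  obtain ⟨a, h_exp, ha⟩ := h.exists_isLaurentExpansion hy h_mem h_pole
  obtain ⟨R, hR, h_sub, -⟩ := id h_exp
  exact ⟨⟨hy, R, hR, h_sub⟩, sInf_le ⟨k, rfl, a, h_exp, ha⟩⟩

end Laurent

/-! ### Spherical Laurent expansions -/

section Pairs

variable {M : Type*} [AddCommGroup M] [TopologicalSpace M] [IsTopologicalAddGroup M] {s : ℤ → M}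
  {x y : M}

theorem hasSum_int_pairs (h : HasSum s x) : HasSum (fun m => s (2 * m) + s (2 * m + 1)) x := by
  have h_prod := (Int.divModEquiv 2).symm.hasSum_iff.2 h
  refine (h_prod.prod_fiberwise fun m => hasSum_fintype _).congr_fun fun m => ?_
  simp [mul_comm]

theorem hasSum_int_of_even_of_odd (hx : HasSum (fun m => s (2 * m)) x)
    (hy : HasSum (fun m => s (2 * m + 1)) y) : HasSum s (x + y) := by
  have h_even : Function.Injective fun m : ℤ => 2 * m := fun m n h => by simpa using h
  have h_odd : Function.Injective fun m : ℤ => 2 * m + 1 := fun m n h => by simpa using h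
  refine HasSum.add_isCompl ?_ (h_even.hasSum_range_iff.2 hx) (h_odd.hasSum_range_iff.2 hy)
  simpa [Function.comp_def] using Int.isCompl_even_odd

end Pairs

section Spherical

variable {A : Type*} [NormedStarAlg A] [IsSliceAlg A] {Ω : Set A} {f : A → A} {J y : A} {w z : ℂ}
  {k : ℕ}

attribute [local instance] IsSliceAlg.finiteDimensional

/-- The stem function of `S_{y,n} · c`, in complex coordinates. -/
def sphericalStem (y : A) (n : ℤ) (c : A) (z : ℂ) : CoordSpace A :=
  toCoord (csmul (deltaStem y z ^ (n / 2))
    (if Even n then (c, 0) else cmul (binomStem y z) (c, 0)))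

theorem sphericalTerm_pt (hJ : J ∈ imagUnits A) (n : ℤ) (c : A) (z : ℂ) :
    sphericalTerm y n c (pt J z) = evCoord J (sphericalStem y n c z) := by
  rw [sphericalStem, evCoord_toCoord]
  exact ind_pt (isStem_sphericalStem y n c _) hJ z

theorem sphericalStem_two_mul (y : A) (m : ℤ) (c : A) (z : ℂ) :
    sphericalStem y (2 * m) c z = deltaStem y z ^ m • toCoord (c, 0) := by
  rw [sphericalStem, if_pos (even_two_mul m), Int.mul_ediv_cancel_left m two_ne_zero, toCoord_csmul]

theorem mulCoord_toCoord_fst (b c : A) :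
    mulCoord (toCoord (b, 0)) (toCoord (c, 0)) = toCoord (b * c, 0) := by
  rw [mulCoord_toCoord]
  congr 1
  ext <;> simp [cmul]

theorem toCoord_binomStem (hy : y ∈ quadCone A) (z : ℂ) :
    toCoord (binomStem y z) = (z - (coord y).re) • toCoord (1, 0) - toCoord (imA y, 0) := by
  obtain ⟨J, hJ, e⟩ := exists_eq_pt_coord hy
  have h_im : imA y = (coord y).im • J := by
    conv_lhs => rw [e, imA_pt hJ]
  rw [← toCoord_csmul, ← map_sub, h_im]
  congr 1
  conv_lhs => rw [e]
  ext
  · simp only [binomStem, pt, csmul, Complex.sub_re, Complex.ofReal_re, Prod.fst_sub]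
    module
  · simp [binomStem, csmul]

theorem sphericalStem_two_mul_add_one (hy : y ∈ quadCone A) (m : ℤ) (c : A) (z : ℂ) :
    sphericalStem y (2 * m + 1) c z = deltaStem y z ^ m •
      ((z - (coord y).re) • toCoord (c, 0) - mulCoord (toCoord (imA y, 0)) (toCoord (c, 0))) := by
  have h_half : (2 * m + 1) / 2 = m := by omega
  rw [sphericalStem, if_neg (Int.not_even_two_mul_add_one m), h_half, toCoord_csmul,
    ← mulCoord_toCoord, toCoord_binomStem hy, map_sub, map_smul, sub_apply,
    smul_apply, mulCoord_toCoord_fst 1, one_mul]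

theorem IsSlice.hasSum_evCoord_iff (h : IsSlice Ω f) (hz : z ∈ sliceDom Ω) {ι : Type*}
    {s : ι → CoordSpace A} :
    (∀ J ∈ imagUnits A, HasSum (fun n => evCoord J (s n)) (f (pt J z))) ↔
      HasSum s (stemCoord f z) := by
  refine ⟨fun h_sum => ?_, fun h_sum J hJ => ?_⟩
  · have hJ := someUnit_mem (A := A)
    have hJ' := neg_mem_imagUnits hJ
    rw [h.stemCoord_eq_add hJ hz]
    exact (((h_sum _ hJ).mapL (epsCoord _)).add ((h_sum _ hJ').mapL (epsCoord _))).congr_fun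
      fun n => (epsCoord_evCoord_add hJ (s n)).symm
  · rw [← h.evCoord_stemCoord hJ hz]
    exact h_sum.mapL (evCoord J)

theorem IsSlice.isSphericalExpansion_iff (h : IsSlice Ω f) (hy : y ∈ quadCone A) {c : ℤ → A} :
    IsSphericalExpansion Ω f y c ↔ ∃ r > 0, ∀ z, 0 < ‖deltaStem y z‖ → ‖deltaStem y z‖ < r →
      z ∈ sliceDom Ω ∧ HasSum (fun n => sphericalStem y n (c n) z) (stemCoord f z) := by
  constructor
  · rintro ⟨r, hr, h_sub, h_sum⟩
    refine ⟨r ^ 2, pow_pos hr 2, fun z h0 hzr => ?_⟩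
    have h_shell : ∀ J ∈ imagUnits A, pt J z ∈ cassiniShell y 0 r := fun J hJ =>
      (pt_mem_cassiniShell_iff hJ hy hr).2 ⟨h0, hzr⟩
    have hz : z ∈ sliceDom Ω := ⟨_, someUnit_mem, h_sub (h_shell _ someUnit_mem)⟩
    refine ⟨hz, (h.hasSum_evCoord_iff hz).1 fun J hJ => ?_⟩
    simpa only [sphericalTerm_pt hJ] using h_sum _ (h_shell J hJ)
  · rintro ⟨r, hr, h_near⟩
    have h_shell : ∀ x ∈ cassiniShell y 0 (Real.sqrt r), ∃ J ∈ imagUnits A, ∃ z, x = pt J z ∧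
        z ∈ sliceDom Ω ∧ HasSum (fun n => sphericalStem y n (c n) z) (stemCoord f z) := by
      intro x hx
      obtain ⟨J, hJ, z, rfl⟩ := mem_quadCone_iff.1 hx.1
      rw [pt_mem_cassiniShell_iff hJ hy (Real.sqrt_pos.2 hr), Real.sq_sqrt hr.le] at hx
      exact ⟨J, hJ, z, rfl, h_near z hx.1 hx.2⟩
    refine ⟨Real.sqrt r, Real.sqrt_pos.2 hr, fun x hx => ?_, fun x hx => ?_⟩ <;>
      obtain ⟨J, hJ, z, rfl, hz, h_sum⟩ := h_shell x hx
    · exact (h.isCircular.pt_mem_iff hJ).2 hz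
    · simpa only [sphericalTerm_pt hJ] using (h.hasSum_evCoord_iff hz).2 h_sum J hJ

theorem IsSphericalExpansion.hasPoleLE (h : IsSlice Ω f) (hy : y ∈ quadCone A)
    (h_im : (coord y).im ≠ 0) {c : ℤ → A} (h_exp : IsSphericalExpansion Ω f y c)
    (hc : ∀ n < -((2 * k : ℕ) : ℤ), c n = 0) (hw : deltaStem y w = 0) :
    HasPoleLE k (stemCoord f) w := by
  obtain ⟨r, hr, h_near⟩ := (h.isSphericalExpansion_iff hy).1 h_exp
  have hc_odd : ∀ m < -(k : ℤ), c (2 * m + 1) = 0 := fun m hm => hc _ (by push_cast; omega)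
  refine hasPoleLE_of_quad_expansion (a := (coord y).re) (β := (coord y).im * Complex.I)
    (U := fun m => toCoord (c (2 * m), 0) - toCoord (imA y * c (2 * m + 1), 0))
    (V := fun m => toCoord (c (2 * m + 1), 0)) (by simpa using h_im) (fun m hm => ?_)
    (fun m hm => by rw [hc_odd m hm, Prod.mk_zero_zero, map_zero]) hr (fun z h0 hz => ?_)
    (by rwa [← deltaStem_eq_quad hy])
  · rw [hc_odd m hm, hc (2 * m) (by push_cast; omega), mul_zero, sub_self]
  · rw [← deltaStem_eq_quad hy] at h0 hz ⊢
    refine (hasSum_int_pairs (h_near z h0 hz).2).congr_fun fun m => ?_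
    rw [sphericalStem_two_mul, sphericalStem_two_mul_add_one hy, mulCoord_toCoord_fst, ← smul_add]
    congr 1
    abel

/-- As for Laurent series, averaging over conjugate points makes the coefficients real. -/
theorem IsSlice.exists_real_quad_expansion (h : IsSlice Ω f) (hy : y ∈ quadCone A)
    (h_im : (coord y).im ≠ 0)
    (h_mem : ∀ w, deltaStem y w = 0 → ∀ᶠ z in 𝓝[≠] w, z ∈ sliceDom Ω)
    (h_pole : ∀ w, deltaStem y w = 0 → HasPoleLE k (stemCoord f) w) :
    ∃ u v : ℤ → A, (∀ n < -(k : ℤ), u n = 0) ∧ (∀ n < -(k : ℤ), v n = 0) ∧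
      ∃ r > 0, ∀ z, 0 < ‖deltaStem y z‖ → ‖deltaStem y z‖ < r → z ∈ sliceDom Ω ∧
        ∃ S T : CoordSpace A, HasSum (fun n => deltaStem y z ^ n • toCoord (u n, (0 : A))) S ∧
          HasSum (fun n => deltaStem y z ^ n • toCoord (v n, (0 : A))) T ∧
          stemCoord f z = S + (z - (coord y).re) • T := by
  have h_quad := deltaStem_eq_quad hy
  obtain ⟨U, V, hU, hV, r, hr, h_sum⟩ := exists_quad_expansion (a := (coord y).re)
    (β := (coord y).im * Complex.I) (by simpa using h_im) (h_quad ▸ h_pole)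
  obtain ⟨r', hr', h_dom⟩ := exists_radius_quad (h_quad ▸ h_mem)
  rw [← h_quad] at h_sum h_dom
  refine ⟨fun n => (toCoord.symm (U n)).1, fun n => (toCoord.symm (V n)).1,
    fun n hn => by simp only [hU n hn, map_zero, Prod.fst_zero],
    fun n hn => by simp only [hV n hn, map_zero, Prod.fst_zero],
    min r r', lt_min hr hr', fun z h0 hzr => ?_⟩
  have h_norm : ‖deltaStem y (conj z)‖ = ‖deltaStem y z‖ := by rw [deltaStem_conj, RCLike.norm_conj]
  have hz := h_dom z h0 (hzr.trans_le (min_le_right _ _))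
  obtain ⟨S, T, hS, hT, h_eq⟩ := h_sum z h0 (hzr.trans_le (min_le_left _ _))
  obtain ⟨S', T', hS', hT', h_eq'⟩ := h_sum (conj z) (by rwa [h_norm])
    (by rw [h_norm]; exact hzr.trans_le (min_le_left _ _))
  simp only [deltaStem_conj, ← map_zpow₀] at hS' hT'
  refine ⟨hz, _, _, hasSum_smul_realPart hS hS', hasSum_smul_realPart hT hT', ?_⟩
  have h_star : stemCoord f z = star S' + (z - (coord y).re) • star T' := by
    rw [← star_star (stemCoord f z), ← h.stemCoord_conj hz, h_eq', star_add, star_smul,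
      RCLike.star_def, map_sub, Complex.conj_conj, Complex.conj_ofReal]
  have h_avg : stemCoord f z = (1 / 2 : ℂ) • (stemCoord f z + stemCoord f z) := by
    rw [← two_smul ℂ, smul_smul, one_div, inv_mul_cancel₀ two_ne_zero, one_smul]
  rw [h_avg]
  nth_rewrite 1 [h_eq]
  rw [h_star]
  module

theorem IsSlice.exists_isSphericalExpansion (h : IsSlice Ω f) (hy : y ∈ quadCone A)
    (h_im : (coord y).im ≠ 0)
    (h_mem : ∀ w, deltaStem y w = 0 → ∀ᶠ z in 𝓝[≠] w, z ∈ sliceDom Ω)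
    (h_pole : ∀ w, deltaStem y w = 0 → HasPoleLE k (stemCoord f) w) :
    ∃ c : ℤ → A, IsSphericalExpansion Ω f y c ∧ ∀ n < -((2 * k : ℕ) : ℤ), c n = 0 := by
  obtain ⟨u, v, hu, hv, r, hr, h_near⟩ := h.exists_real_quad_expansion hy h_im h_mem h_pole
  let c (n : ℤ) : A := if Even n then u (n / 2) + imA y * v (n / 2) else v (n / 2)
  have hc_even (m : ℤ) : c (2 * m) = u m + imA y * v m := by
    simp only [c, if_pos (even_two_mul m), Int.mul_ediv_cancel_left m two_ne_zero]
  have hc_odd (m : ℤ) : c (2 * m + 1) = v m := by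
    have h_half : (2 * m + 1) / 2 = m := by omega
    simp only [c, if_neg (Int.not_even_two_mul_add_one m), h_half]
  refine ⟨c, (h.isSphericalExpansion_iff hy).2 ⟨r, hr, fun z h0 hzr => ?_⟩, fun n hn => ?_⟩
  · obtain ⟨hz, S, T, hS, hT, h_eq⟩ := h_near z h0 hzr
    have hT_mul := hT.mapL (mulCoord (toCoord (imA y, (0 : A))))
    have h_even : HasSum (fun m => sphericalStem y (2 * m) (c (2 * m)) z) _ :=
      (hS.add hT_mul).congr_fun fun m => by
        rw [sphericalStem_two_mul, hc_even, map_smul, mulCoord_toCoord_fst, ← smul_add, ← map_add,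
          Prod.mk_add_mk, add_zero]
    have h_odd : HasSum (fun m => sphericalStem y (2 * m + 1) (c (2 * m + 1)) z) _ :=
      ((hT.const_smul (z - (coord y).re)).sub hT_mul).congr_fun fun m => by
        rw [sphericalStem_two_mul_add_one hy, hc_odd, map_smul, smul_sub, smul_comm]
    have h_split (W : CoordSpace A) : stemCoord f z = (S + W) + ((z - (coord y).re) • T - W) := by
      rw [h_eq]
      abel
    rw [h_split (mulCoord (toCoord (imA y, 0)) T)]
    exact ⟨hz, hasSum_int_of_even_of_odd (s := fun n => sphericalStem y n (c n) z) h_even h_odd⟩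
  · have h_half : n / 2 < -(k : ℤ) := by omega
    simp only [c, hu _ h_half, hv _ h_half, mul_zero, add_zero, ite_self]

theorem IsSlice.sphericalOrd_le (h : IsSlice Ω f) (hy : y ∈ quadCone A)
    (h_im : (coord y).im ≠ 0)
    (h_mem : ∀ w, deltaStem y w = 0 → ∀ᶠ z in 𝓝[≠] w, z ∈ sliceDom Ω)
    (h_pole : ∀ w, deltaStem y w = 0 → HasPoleLE k (stemCoord f) w) :
    sphericalOrd Ω f y ≤ (2 * k : ℕ) := by
  obtain ⟨c, h_exp, hc⟩ := h.exists_isSphericalExpansion hy h_im h_mem h_pole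
  exact sInf_le ⟨k, rfl, c, h_exp, hc⟩

end Spherical

/-! ### Semiregularity and orders of the reciprocal -/

section Reciprocal

variable {A : Type*} [NormedStarAlg A] {Ω Ω' : Set A} {f g : A → A} {y : A} {w z₀ : ℂ} {k : ℕ}
  {m : ℤ}

theorem IsSemiregular.isCircular (h : IsSemiregular Ω Ω' f) : IsCircular Ω := h.2.1.1

theorem IsSemiregular.isSliceRegular (h : IsSemiregular Ω Ω' f) : IsSliceRegular Ω' f :=
  h.2.2.2.1

variable [IsSliceAlg A]

attribute [local instance] IsSliceAlg.finiteDimensional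

theorem IsSliceRegular.differentiableOn_normStem (h : IsSliceRegular Ω f) :
    DifferentiableOn ℂ (normStem f) (sliceDom Ω) := by
  have hd := h.differentiableOn_stemCoord
  have h_mul : DifferentiableOn ℂ
      (fun z => mulCoord (stemCoord f z) (cstarCoord (stemCoord f z))) (sliceDom Ω) :=
    ((mulCoord (A := A)).differentiable.comp_differentiableOn hd).clm_apply
      (cstarCoord.differentiable.comp_differentiableOn hd)
  exact ((scalCoord (A := A)).differentiable.comp_differentiableOn h_mul).congr
    fun z _ => normStem_eq f z

theorem meromorphicAt_normStem (h : MeromorphicAt (stemCoord f) z₀) :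
    MeromorphicAt (normStem f) z₀ := by
  obtain ⟨n, hn⟩ := h
  have h_mul : AnalyticAt ℂ (fun z => mulCoord ((z - z₀) ^ n • stemCoord f z)
      (cstarCoord ((z - z₀) ^ n • stemCoord f z))) z₀ :=
    ((mulCoord (A := A)).analyticAt_bilinear _).comp₂ hn ((cstarCoord.analyticAt _).fun_comp hn)
  refine ⟨n + n, (((scalCoord (A := A)).analyticAt _).fun_comp h_mul).congr
    (Eventually.of_forall fun z => ?_)⟩
  simp only [map_smul, FunLike.coe_smul, Pi.smul_apply, normStem_eq, pow_add, smul_eq_mul]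
  ring

theorem IsTame.isSliceRegular_sliceInv (h : IsTame Ω f) (hr : IsSliceRegular Ω f)
    (hne : (invDomain Ω f).Nonempty) : IsSliceRegular (invDomain Ω f) (sliceInv f) := by
  have hd := hr.differentiableOn_normStem
  have ho : IsCircularOpen (invDomain Ω f) := by
    rw [h.invDomain_eq_circ]
    exact isCircularOpen_circ
      (hd.continuousOn.isOpen_inter_preimage hr.2.1.isOpen_sliceDom isOpen_ne)
      h.conj_mem_setOf_normStem_ne_zero
  refine (h.isSlice_sliceInv hne).isSliceRegular ho ?_
  rw [h.sliceDom_invDomain]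
  exact (((hd.mono fun z hz => hz.1).fun_inv fun z hz => hz.2).smul
    ((cstarCoord.differentiable.comp_differentiableOn hr.differentiableOn_stemCoord).mono
      fun z hz => hz.1)).congr fun z hz => h.stemCoord_sliceInv hz.1

theorem IsSemiregular.pt_mem_diff (h : IsSemiregular Ω Ω' f) (hz : z₀ ∈ sliceDom Ω)
    (hz' : z₀ ∉ sliceDom Ω') {J : A} (hJ : J ∈ imagUnits A) : pt J z₀ ∈ Ω \ Ω' :=
  ⟨(h.isCircular.pt_mem_iff hJ).2 hz, fun h_mem => hz' ⟨J, hJ, h_mem⟩⟩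

theorem IsSemiregular.eventually_mem_sliceDom (h : IsSemiregular Ω Ω' f) (hz : z₀ ∈ sliceDom Ω) :
    ∀ᶠ z in 𝓝[≠] z₀, z ∈ sliceDom Ω' := by
  by_cases hz' : z₀ ∈ sliceDom Ω'
  · exact eventually_nhdsWithin_of_eventually_nhds
      (h.isSliceRegular.2.1.isOpen_sliceDom.mem_nhds hz')
  · have hJ := someUnit_mem (A := A)
    rcases h.2.2.2.2 _ (h.pt_mem_diff hz hz' hJ) with h_pole | h_rem
    · exact h_pole.1.eventually_mem_sliceDom hJ
    · exact h_rem.1.eventually_mem_sliceDom hJ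

theorem IsSemiregular.meromorphicAt_stemCoord (h : IsSemiregular Ω Ω' f)
    (hz : z₀ ∈ sliceDom Ω) : MeromorphicAt (stemCoord f) z₀ := by
  by_cases hz' : z₀ ∈ sliceDom Ω'
  · exact (h.isSliceRegular.analyticAt_stemCoord hz').meromorphicAt
  have hs := h.isSliceRegular.isSlice
  have hJ := someUnit_mem (A := A)
  have hJ_neg := neg_mem_imagUnits hJ
  rcases h.2.2.2.2 _ (h.pt_mem_diff hz hz' hJ) with h_pole | h_rem
  · rcases h.2.2.2.2 _ (h.pt_mem_diff hz hz' hJ_neg) with h_pole_neg | h_rem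
    · obtain ⟨k, hk⟩ := h_pole.exists_hasPoleLE hJ
      obtain ⟨l, hl⟩ := h_pole_neg.exists_hasPoleLE hJ_neg
      refine (hk.meromorphicAt.add hl.meromorphicAt).congr ?_
      filter_upwards [h.eventually_mem_sliceDom hz] with z hz
      exact (hs.stemCoord_eq_add hJ hz).symm
    · exact (h_rem.hasPoleLE hs.isCircular hJ_neg).meromorphicAt
  · exact (h_rem.hasPoleLE hs.isCircular hJ).meromorphicAt

theorem IsSemiregular.eventually_normStem_ne_zero (h : IsSemiregular Ω Ω' f) (ht : IsTame Ω' f)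
    (hN : NowhereIdenticallyZero Ω Ω' (normalFn f)) (hz : z₀ ∈ sliceDom Ω) :
    ∀ᶠ z in 𝓝[≠] z₀, normStem f z ≠ 0 := by
  have hr := h.isSliceRegular
  have hm : MeromorphicOn (normStem f) (connectedComponentIn (sliceDom Ω) z₀) := fun z hz =>
    meromorphicAt_normStem (h.meromorphicAt_stemCoord (connectedComponentIn_subset _ _ hz))
  have hz₀ := mem_connectedComponentIn hz
  obtain ⟨x, ⟨hx, w, hw, J, hJ, rfl⟩, hne⟩ := hN z₀ hz
  have hw_mem : w ∈ sliceDom Ω' := ⟨J, hJ, hx⟩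
  rw [ht.normalFn_pt hJ hw_mem, Ne, pt_eq_zero_iff hJ] at hne
  have h_cont : ContinuousAt (normStem f) w :=
    hr.differentiableOn_normStem.continuousOn.continuousAt
      (hr.2.1.isOpen_sliceDom.mem_nhds hw_mem)
  have h_order : meromorphicOrderAt (normStem f) w ≠ ⊤ :=
    (meromorphicOrderAt_ne_top_iff_eventually_ne_zero (hm w hw)).2
      (eventually_nhdsWithin_of_eventually_nhds (h_cont.eventually_ne hne))
  exact (meromorphicOrderAt_ne_top_iff_eventually_ne_zero (hm z₀ hz₀)).1
    (hm.meromorphicOrderAt_ne_top_of_isPreconnected isPreconnected_connectedComponentIn hw hz₀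
      h_order)

theorem IsSemiregular.nonempty_invDomain (h : IsSemiregular Ω Ω' f)
    (hN : NowhereIdenticallyZero Ω Ω' (normalFn f)) : (invDomain Ω' f).Nonempty := by
  obtain ⟨y, hy⟩ := h.1
  obtain ⟨x, hx, hne⟩ := hN _ (h.isCircular.coord_mem hy)
  exact ⟨x, hx.1, hne⟩

theorem IsTame.stemCoord_sliceInv_eventuallyEq (h : IsTame Ω f)
    (h_mem : ∀ᶠ z in 𝓝[≠] z₀, z ∈ sliceDom Ω) :
    ∀ᶠ z in 𝓝[≠] z₀,
      (normStem f z)⁻¹ • cstarCoord (stemCoord f z) = stemCoord (sliceInv f) z :=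
  h_mem.mono fun _ hz => (h.stemCoord_sliceInv hz).symm

theorem IsSemiregular.sliceInv (h : IsSemiregular Ω Ω' f) (ht : IsTame Ω' f)
    (hN : NowhereIdenticallyZero Ω Ω' (normalFn f)) :
    IsSemiregular Ω (invDomain Ω' f) (sliceInv f) := by
  have hne := h.nonempty_invDomain hN
  refine ⟨h.1, h.2.1, invDomain_subset.trans h.2.2.1,
    ht.isSliceRegular_sliceInv h.isSliceRegular hne, fun y hy => Or.inl ?_⟩
  have hz := h.isCircular.coord_mem hy.1
  have h_mem := h.eventually_mem_sliceDom hz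
  have hf := h.meromorphicAt_stemCoord hz
  obtain ⟨l, hl⟩ := exists_hasPoleLE hf
  obtain ⟨k, hk⟩ := exists_hasPoleLE
    (((meromorphicAt_normStem hf).inv.smul (hl.clm_comp cstarCoord).meromorphicAt).congr
      (ht.stemCoord_sliceInv_eventuallyEq h_mem))
  have h_mem_inv : ∀ᶠ z in 𝓝[≠] coord y, z ∈ sliceDom (invDomain Ω' f) := by
    rw [ht.sliceDom_invDomain]
    exact h_mem.and (h.eventually_normStem_ne_zero ht hN hz)
  obtain ⟨h_sing, h_ord⟩ := (ht.isSlice_sliceInv hne).isSingularity_and_ord_le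
    (h.isCircular.subset_quadCone hy.1) h_mem_inv hk
  exact ⟨h_sing, h_ord.trans_lt (ENat.natCast_lt_top k)⟩

section Factorization

theorem isCircular_cassiniShell (hy : y ∈ quadCone A) {r : ℝ} (hr : 0 < r) :
    IsCircular (cassiniShell y 0 r) := by
  refine ⟨{z | 0 < ‖deltaStem y z‖ ∧ ‖deltaStem y z‖ < r ^ 2}, Set.Subset.antisymm ?_ ?_⟩
  · intro x hx
    obtain ⟨J, hJ, h_eq⟩ := exists_eq_pt_coord hx.1
    rw [h_eq] at hx
    exact ⟨coord x, (pt_mem_cassiniShell_iff hJ hy hr).1 hx, J, hJ, h_eq⟩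
  · rintro _ ⟨z, hz, J, hJ, rfl⟩
    exact (pt_mem_cassiniShell_iff hJ hy hr).2 hz

theorem eventually_mem_sliceDom_cassiniShell (hy : y ∈ quadCone A) {r : ℝ} (hr : 0 < r)
    (hw : deltaStem y w = 0) : ∀ᶠ z in 𝓝[≠] w, z ∈ sliceDom (cassiniShell y 0 r) := by
  have hJ := someUnit_mem (A := A)
  have h_lt : ∀ᶠ z in 𝓝 w, ‖deltaStem y z‖ < r ^ 2 := by
    have h_cont : ContinuousAt (fun z => ‖deltaStem y z‖) w := by
      rw [deltaStem_eq_quad hy]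
      exact (analyticAt_quad _ _ w).continuousAt.norm
    refine h_cont.eventually_lt_const ?_
    beta_reduce
    rw [hw, norm_zero]
    exact pow_pos hr 2
  filter_upwards [eventually_nhdsWithin_of_eventually_nhds h_lt, self_mem_nhdsWithin,
    eventually_nhdsNE_ne_conj w] with z hz_lt hz hz_conj
  refine ⟨_, hJ, (pt_mem_cassiniShell_iff hJ hy hr).2 ⟨norm_pos_iff.2 fun h_zero => ?_, hz_lt⟩⟩
  rcases (deltaStem_eq_zero_iff hy).1 hw with rfl | rfl <;>
    rcases (deltaStem_eq_zero_iff hy).1 h_zero with rfl | rfl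
  · exact hz rfl
  · exact hz_conj rfl
  · exact hz_conj (Complex.conj_conj _).symm
  · exact hz rfl

theorem mem_sliceDom_cassiniBall (hy : y ∈ quadCone A) {r : ℝ} (hr : 0 < r)
    (hw : deltaStem y w = 0) : w ∈ sliceDom (cassiniBall y r) := by
  have hJ := someUnit_mem (A := A)
  refine ⟨_, hJ, (pt_mem_cassiniBall_iff hJ hy hr).2 ?_⟩
  rw [hw, norm_zero]
  exact pow_pos hr 2

theorem IsSlice.stemCoord_ne_zero (hg : IsSlice Ω g) (hy : y ∈ quadCone A)
    (h_ne : ∃ x ∈ sphere y, g x ≠ 0) (hw : deltaStem y w = 0) (hw_mem : w ∈ sliceDom Ω) :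
    stemCoord g w ≠ 0 := by
  rintro h_zero
  have hw_conj := hg.isCircular.conj_mem hw_mem
  have h_coord : coord y ∈ sliceDom Ω ∧ stemCoord g (coord y) = 0 := by
    rcases (deltaStem_eq_zero_iff hy).1 hw with rfl | rfl
    · exact ⟨hw_mem, h_zero⟩
    · rw [Complex.conj_conj] at hw_conj
      rw [hg.stemCoord_conj hw_conj, star_eq_zero] at h_zero
      exact ⟨hw_conj, h_zero⟩
  obtain ⟨x, ⟨z, rfl, J, hJ, rfl⟩, hx⟩ := h_ne
  rw [← hg.evCoord_stemCoord hJ h_coord.1, h_coord.2, map_zero] at hx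
  exact hx rfl

theorem IsTame.zpow_smul_stemCoord_eq (h : IsTame Ω f) (hy : y ∈ quadCone A) {r : ℝ} (hr : 0 < r)
    (h_sub : cassiniShell y 0 r ⊆ Ω) (hg : IsSliceRegular (cassiniBall y r) g) {δ : ℂ → ℂ}
    (hδ_conj : ∀ z, δ (conj z) = conj (δ z))
    (h_fac : ∀ x ∈ cassiniShell y 0 r,
      normalFn f x = ind (fun z => csmul (δ z ^ m) (stem g z)) x)
    {z : ℂ} (hz : z ∈ sliceDom (cassiniShell y 0 r)) :
    δ z ^ m • stemCoord g z = normStem f z • toCoord (1, 0) := by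
  have hc := isCircular_cassiniShell hy hr
  have h_ball : sliceDom (cassiniShell y 0 r) ⊆ sliceDom (cassiniBall y r) :=
    sliceDom_mono fun x hx => ⟨hx.1, hx.2.2⟩
  have h_stem : IsStem (sliceDom (cassiniShell y 0 r)) (fun z => csmul (δ z ^ m) (stem g z)) :=
    isStem_csmul (fun z _ => by rw [hδ_conj, map_zpow₀]) (hg.isSlice.isStem_stem.mono h_ball)
  rw [stemCoord, ← toCoord_csmul, ← toCoord_csmul, ← h.stem_normalFn (sliceDom_mono h_sub hz),
    stem_congr hc h_fac hz, stem_ind hc h_stem hz]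

theorem meromorphicOrderAt_smul_eq_zpow {E : Type*} [NormedAddCommGroup E] [NormedSpace ℂ E]
    {G : ℂ → E} {u δ : ℂ → ℂ} {e : E} (he : e ≠ 0) (hu : MeromorphicAt u w)
    (hδ : meromorphicOrderAt δ w = 1) (hG : AnalyticAt ℂ G w) (hG_ne : G w ≠ 0)
    (h_eq : ∀ᶠ z in 𝓝[≠] w, δ z ^ m • G z = u z • e) : meromorphicOrderAt u w = m := by
  have order_eq_zero : ∀ {H : ℂ → E}, AnalyticAt ℂ H w → H w ≠ 0 →
      meromorphicOrderAt H w = 0 := fun hH hH_ne => by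
    rw [hH.meromorphicOrderAt_eq, hH.analyticOrderAt_eq_zero.2 hH_ne]
    rfl
  have hδ_mer : MeromorphicAt δ w := meromorphicAt_of_meromorphicOrderAt_ne_zero (by simp [hδ])
  have h_order : meromorphicOrderAt ((δ ^ m) • G) w = meromorphicOrderAt (u • fun _ => e) w :=
    meromorphicOrderAt_congr h_eq
  rw [meromorphicOrderAt_smul (hδ_mer.zpow m) hG.meromorphicAt,
    meromorphicOrderAt_smul hu analyticAt_const.meromorphicAt, meromorphicOrderAt_zpow hδ_mer, hδ,
    order_eq_zero hG hG_ne, order_eq_zero analyticAt_const he] at h_order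
  simpa using h_order.symm

theorem IsTame.meromorphicOrderAt_normStem (h : IsTame Ω f) (hy : y ∈ quadCone A) {r : ℝ}
    (hr : 0 < r) (h_sub : cassiniShell y 0 r ⊆ Ω) (hg : IsSliceRegular (cassiniBall y r) g)
    (hg_ne : ∃ x ∈ sphere y, g x ≠ 0) {δ : ℂ → ℂ} (hδ_conj : ∀ z, δ (conj z) = conj (δ z))
    (h_fac : ∀ x ∈ cassiniShell y 0 r,
      normalFn f x = ind (fun z => csmul (δ z ^ m) (stem g z)) x)
    (hw : deltaStem y w = 0) (hδ : meromorphicOrderAt δ w = 1)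
    (h_mer : MeromorphicAt (normStem f) w) : meromorphicOrderAt (normStem f) w = m := by
  have h_one : toCoord ((1 : A), (0 : A)) ≠ 0 := by
    rw [Ne, map_eq_zero_iff _ toCoord.injective, Prod.mk_eq_zero, not_and_or]
    exact Or.inl IsSliceAlg.one_ne_zero
  have hw_ball := mem_sliceDom_cassiniBall hy hr hw
  exact meromorphicOrderAt_smul_eq_zpow h_one h_mer hδ (hg.analyticAt_stemCoord hw_ball)
    (hg.isSlice.stemCoord_ne_zero hy hg_ne hw hw_ball)
    ((eventually_mem_sliceDom_cassiniShell hy hr hw).mono fun z hz =>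
      h.zpow_smul_stemCoord_eq hy hr h_sub hg hδ_conj h_fac hz)

end Factorization

theorem IsTame.eventually_mem_sliceDom_invDomain (h : IsTame Ω f)
    (h_mem : ∀ᶠ z in 𝓝[≠] w, z ∈ sliceDom Ω) (h_mer : MeromorphicAt (normStem f) w)
    (hm : meromorphicOrderAt (normStem f) w = m) :
    ∀ᶠ z in 𝓝[≠] w, z ∈ sliceDom (invDomain Ω f) := by
  rw [h.sliceDom_invDomain]
  refine h_mem.and ((meromorphicOrderAt_ne_top_iff_eventually_ne_zero h_mer).1 ?_)
  rw [hm]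
  exact WithTop.coe_ne_top

theorem IsTame.hasPoleLE_stemCoord_sliceInv (h : IsTame Ω f)
    (h_mem : ∀ᶠ z in 𝓝[≠] w, z ∈ sliceDom Ω) (h_pole : HasPoleLE k (stemCoord f) w)
    (hm : meromorphicOrderAt (normStem f) w = m) :
    HasPoleLE (m.toNat + k) (stemCoord (sliceInv f)) w :=
  ((h_pole.clm_comp cstarCoord).inv_smul (meromorphicAt_normStem h_pole.meromorphicAt) hm).congr
    (h.stemCoord_sliceInv_eventuallyEq h_mem)

theorem IsTame.isSlice_sliceInv_of_eventually (h : IsTame Ω f)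
    (h_mem : ∀ᶠ z in 𝓝[≠] w, z ∈ sliceDom (invDomain Ω f)) :
    IsSlice (invDomain Ω f) (sliceInv f) := by
  obtain ⟨_, J, -, hx⟩ := h_mem.exists
  exact h.isSlice_sliceInv ⟨_, hx⟩

theorem IsTame.sphericalOrd_sliceInv_le (h : IsTame Ω f) (hy : y ∈ quadCone A)
    (h_im : (coord y).im ≠ 0) :
    sphericalOrd (invDomain Ω f) (sliceInv f) y ≤
      sphericalMult Ω (normalFn f) y + sphericalOrd Ω f y := by
  rcases eq_or_ne (sphericalMult Ω (normalFn f) y) ⊤ with h_top | h_mult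
  · rw [h_top, top_add]
    exact le_top
  rcases eq_or_ne (sphericalOrd Ω f y) ⊤ with h_top | h_ord
  · rw [h_top, add_top]
    exact le_top
  obtain ⟨m, ⟨r, hr, h_sub, g, hg, hg_ne, h_fac⟩, hm⟩ := sInf_mem_of_ne_top h_mult
  obtain ⟨k, hk, c, h_exp, hc⟩ := sInf_mem_of_ne_top h_ord
  have h_pole : ∀ w, deltaStem y w = 0 → HasPoleLE k (stemCoord f) w := fun w hw =>
    h_exp.hasPoleLE h.isSlice hy h_im hc hw
  have h_order : ∀ w, deltaStem y w = 0 → meromorphicOrderAt (normStem f) w = m := by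
    intro w hw
    refine h.meromorphicOrderAt_normStem hy hr h_sub hg hg_ne (deltaStem_conj y) h_fac hw ?_
      (meromorphicAt_normStem (h_pole w hw).meromorphicAt)
    rw [deltaStem_eq_quad hy] at hw ⊢
    exact meromorphicOrderAt_quad
      (mul_ne_zero (Complex.ofReal_ne_zero.2 h_im) Complex.I_ne_zero) hw
  have h_mem : ∀ w, deltaStem y w = 0 → ∀ᶠ z in 𝓝[≠] w, z ∈ sliceDom Ω := fun w hw =>
    (eventually_mem_sliceDom_cassiniShell hy hr hw).mono fun z hz => sliceDom_mono h_sub hz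
  have h_mem_inv : ∀ w, deltaStem y w = 0 → ∀ᶠ z in 𝓝[≠] w, z ∈ sliceDom (invDomain Ω f) :=
    fun w hw => h.eventually_mem_sliceDom_invDomain (h_mem w hw)
      (meromorphicAt_normStem (h_pole w hw).meromorphicAt) (h_order w hw)
  have h_slice := h.isSlice_sliceInv_of_eventually
    (h_mem_inv (coord y) ((deltaStem_eq_zero_iff hy).2 (Or.inl rfl)))
  refine (h_slice.sphericalOrd_le hy h_im h_mem_inv fun w hw =>
    h.hasPoleLE_stemCoord_sliceInv (h_mem w hw) (h_pole w hw) (h_order w hw)).trans_eq ?_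
  rw [sphericalMult, hm, sphericalOrd, hk, ← Nat.cast_add, mul_add]

theorem IsTame.ord_sliceInv_le (h : IsTame Ω f) (hy : y ∈ quadCone A) (h_im : (coord y).im = 0) :
    ord (invDomain Ω f) (sliceInv f) y ≤ classicalMult Ω (normalFn f) y + ord Ω f y := by
  rcases eq_or_ne (classicalMult Ω (normalFn f) y) ⊤ with h_top | h_mult
  · rw [h_top, top_add]
    exact le_top
  rcases eq_or_ne (ord Ω f y) ⊤ with h_top | h_ord
  · rw [h_top, add_top]
    exact le_top
  obtain ⟨m, ⟨r, hr, h_sub, g, hg, hg_ne, h_fac⟩, hm⟩ := sInf_mem_of_ne_top h_mult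
  obtain ⟨k, hk, a, h_exp, ha⟩ := exists_isLaurentExpansion_of_ord_ne_top h_ord
  obtain ⟨J, hJ, hy_eq⟩ := exists_eq_pt_coord hy
  have hy_eq_neg : y = pt (-J) (coord y) := by
    rw [pt_neg, Complex.conj_eq_iff_im.2 h_im]
    exact hy_eq
  have hw : deltaStem y (coord y) = 0 := (deltaStem_eq_zero_iff hy).2 (Or.inl rfl)
  have h_mem : ∀ᶠ z in 𝓝[≠] coord y, z ∈ sliceDom Ω :=
    (eventually_mem_sliceDom_cassiniShell hy hr hw).mono fun z hz => sliceDom_mono h_sub hz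
  have h_pole : HasPoleLE k (stemCoord f) (coord y) :=
    h.isSlice.hasPoleLE_stemCoord hJ h_mem
      (IsLaurentExpansion.hasPoleLE hJ (hy_eq ▸ h_exp) ha)
      (IsLaurentExpansion.hasPoleLE (neg_mem_imagUnits hJ) (hy_eq_neg ▸ h_exp) ha)
  have h_re : ((reR y : ℝ) : ℂ) = coord y := Complex.ext rfl h_im.symm
  have h_mer := meromorphicAt_normStem h_pole.meromorphicAt
  have h_order : meromorphicOrderAt (normStem f) (coord y) = m :=
    h.meromorphicOrderAt_normStem hy hr h_sub hg ⟨y, ⟨coord y, rfl, J, hJ, hy_eq⟩, hg_ne⟩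
      (fun z => by rw [map_sub, Complex.conj_ofReal]) h_fac hw
      (h_re ▸ meromorphicOrderAt_id_sub_const) h_mer
  have h_mem_inv := h.eventually_mem_sliceDom_invDomain h_mem h_mer h_order
  refine ((h.isSlice_sliceInv_of_eventually h_mem_inv).isSingularity_and_ord_le hy h_mem_inv
    (h.hasPoleLE_stemCoord_sliceInv h_mem h_pole h_order)).2.trans_eq ?_
  rw [classicalMult, hm, hk, Nat.cast_add]

end Reciprocal

end SliceReg

end

theorem mainTheorem6 {A : Type*} [NormedStarAlg A] [SliceReg.IsSliceAlg A]
    (Ω Ω' : Set A) (f : A → A)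
    (hf : SliceReg.IsSemiregular Ω Ω' f)
    (htame : SliceReg.IsTame Ω' f)
    (hN : SliceReg.NowhereIdenticallyZero Ω Ω' (SliceReg.normalFn f))
    (Ω'' : Set A) (hΩ'' : Ω'' = {x ∈ Ω' | SliceReg.normalFn f x ≠ 0}) :
    (SliceReg.IsSlice Ω'' (SliceReg.sliceInv f) ∧
      ∀ x ∈ Ω'', SliceReg.sliceMul f (SliceReg.sliceInv f) x = 1 ∧
        SliceReg.sliceMul (SliceReg.sliceInv f) f x = 1) ∧
    SliceReg.IsSemiregular Ω Ω'' (SliceReg.sliceInv f) ∧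
    SliceReg.IsTame Ω'' (SliceReg.sliceInv f) ∧
    (∀ y ∈ Ω, y ∉ Set.range (fun r : ℝ => r • (1 : A)) →
      SliceReg.sphericalOrd Ω'' (SliceReg.sliceInv f) y ≤
        SliceReg.sphericalMult Ω' (SliceReg.normalFn f) y + SliceReg.sphericalOrd Ω' f y) ∧
    (∀ y ∈ Ω, y ∈ Set.range (fun r : ℝ => r • (1 : A)) →
      SliceReg.ord Ω'' (SliceReg.sliceInv f) y ≤
        SliceReg.classicalMult Ω' (SliceReg.normalFn f) y + SliceReg.ord Ω' f y) := by
  subst hΩ''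
  have hΩ := hf.isCircular
  have hne := hf.nonempty_invDomain hN
  refine ⟨⟨htame.isSlice_sliceInv hne, fun x hx => htame.sliceMul_sliceInv hx⟩,
    hf.sliceInv htame hN, htame.isTame_sliceInv hne, fun y hy hyr => ?_, fun y hy hyr => ?_⟩
  · have hq := hΩ.subset_quadCone hy
    exact htame.sphericalOrd_sliceInv_le hq fun h => hyr ((SliceReg.coord_im_eq_zero_iff hq).1 h)
  · have hq := hΩ.subset_quadCone hy
    exact htame.ord_sliceInv_le hq ((SliceReg.coord_im_eq_zero_iff hq).2 hyr)
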